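/- **Setting.** Let $K$ be a (strict) 2-category. A 1-arrow $f\colon x\to y$ is *ff* (representably fully faithful) if for all $g,h\colon z\to x$ each 2-arrow $f g\Rightarrow f h$ is the whiskering with $f$ of a unique 2-arrow $g\Rightarrow h$. A *singleton strict pretopology* $\mathsf J$ on $K$ is a class of 1-arrows that contains all identities, is closed under composition, and is equipped with a specified strict pullback $u\xleftarrow{\mathrm{pr}_1} u\times_y v\xrightarrow{\mathrm{pr}_2} v$ of every $l\colon v\to y$ in $\mathsf J$ along every $f\colon u\to y$, with $\mathrm{pr}_1\in\mathsf J$; when $f$ or $l$ is an identity, the specified pullback is the trivial one (the projection parallel to the identity is an identity, the other projection is the other arrow). It is *totally strict subcanonical* if for every $p\colon u\to x$ in $\mathsf J$, all $f,g\colon x\to y$ and every $\alpha\colon f p\Rightarrow g p$ whose whiskerings with the two projections $u\times_x u\to u$ agree, there is a unique $\beta\colon f\Rightarrow g$ with $\beta p=\alpha$. Assume $\mathsf J$ is totally strict subcanonical and every element of $\mathsf J$ is ff. Two 1-arrows into the source of an ff 1-arrow $l$ with equal composites with $l$ are then joined by a unique 2-arrow whose whiskering with $l$ is the identity; it is called *canonical*.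 **Fractions.** A *$\mathsf J$-fraction* $(j,f)$ from $x$ to $y$ is a span $x\xleftarrow{j}u\xrightarrow{f}y$ with $j\in\mathsf J$; composition of fractions is the composite span $x\leftarrow u\times_y v\to z$, and the identity of $x$ is $(\mathrm{id}_x,\mathrm{id}_x)$. For fractions $(j,f)$, $(k,g)$ from $x$ to $y$, with middle objects $u,v$, a *map* $(j,f)\Rightarrow(k,g)$ is a 2-arrow $f\,\mathrm{pr}_1\Rightarrow g\,\mathrm{pr}_2$ on $u\times_x v$. A *renaming map* from $(j,f)$ to $(k,g)$ consists of $r\colon u\to v$ with $k r=j$ and a 2-arrow $a_r\colon f\Rightarrow g r$; it induces the map $\iota(r)\colon f\,\mathrm{pr}_1\Rightarrow g r\,\mathrm{pr}_1\Rightarrow g\,\mathrm{pr}_2$ composed of $a_r$ and of the canonical 2-arrow $r\,\mathrm{pr}_1\Rightarrow\mathrm{pr}_2$ (lifts through $k$). **Proposition.** The objects of $K$, the $\mathsf J$-fractions with the above composition and identities as 1-arrows, and the maps of fractions as 2-arrows form a bicategory $K_{\mathsf J}$ with the following structure; in particular the descents below exist and are unique. 1. The identity 2-arrow of a fraction is $\iota(\mathrm{id}_u)$,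 for the identity renaming map. The vertical composite of $t_1\colon(j_1,f_1)\Rightarrow(j_2,f_2)$ and $t_2\colon(j_2,f_2)\Rightarrow(j_3,f_3)$ is the unique map $(j_1,f_1)\Rightarrow(j_3,f_3)$ whose restriction along $\mathrm{pr}_{13}\colon u_1\times_x u_2\times_x u_3\to u_1\times_x u_3$ is the pasting of $t_1$ restricted along $\mathrm{pr}_{12}$ and $t_2$ restricted along $\mathrm{pr}_{23}$. 2. Right whiskering of $t\colon(j,f)\Rightarrow(k,g)$, between fractions from $x$ to $y$ with middle objects $u,v$, by $y\xleftarrow{l}w\xrightarrow{h}z$: restrict $t$ along the canonical 1-arrow $(u\times_y w)\times_x(v\times_y w)\to u\times_x v$, lift it uniquely through $l$ to a 2-arrow between the two projections to $w$, and whisker with $h$. 3. Left whiskering of $t\colon(k_1,g_1)\Rightarrow(k_2,g_2)$, between fractions from $y$ to $z$ with middle objects $v_1,v_2$, by $x\xleftarrow{j}u\xrightarrow{f}y$: put $w_i=u\times_y v_i$, $w_{12}=w_1\times_u w_2$ and $W_{12}=w_1\times_x w_2$, and let $t'$ be the restriction of $t$ along the canonical 1-arrow $w_{12}\to v_1\times_y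 v_2$. The whiskered map is the unique 2-arrow on $W_{12}$ whose restriction along $\mathrm{pr}_2\colon w_{12}\times_x W_{12}\to W_{12}$ is the pasting of the canonical 2-arrow from $\mathrm{pr}_2$ to $w_{12}\times_x W_{12}\to w_{12}\to W_{12}$ (lifts through $W_{12}\to x$), of $t'$, and of the canonical 2-arrow back to $\mathrm{pr}_2$. 4. These whiskerings are functorial and satisfy the interchange law, so they define horizontal composition. The associator of three composable fractions with middle objects $u,v,w$ is $\iota(a)$, for the renaming map given by the canonical 1-arrow $(u\times v)\times w\to u\times(v\times w)$ (pullbacks over the appropriate objects) and an identity 2-arrow. 5. Composition of fractions is strictly unital: $(j,f)$ composed on either side with an identity fraction is $(j,f)$, and the unitors are identities. -/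

import Mathlib

open CategoryTheory Bicategory

universe w v u

-- In a strict bicategory, read `x ⟶ y` and `f ≫ g` through the bicategory structure itself.
attribute [instance 2000] CategoryStruct.toQuiver Bicategory.toCategoryStruct

noncomputable section

/-! ### Representably fully faithful 1-arrows and singleton strict pretopologies -/

/-- A 1-arrow `f : x ⟶ y` is *ff* (representably fully faithful) if whiskering with `f` is a
bijection on 2-arrows between parallel 1-arrows into `x`. -/
def IsFF {K : Type u} [Bicategory.{w, v} K] {x y : K} (f : x ⟶ y) : Prop :=
  ∀ ⦃z : K⦄ (g h : z ⟶ x) (α : g ≫ f ⟶ h ≫ f), ∃! a : g ⟶ h, a ▷ f = α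

/-- A span `left ⟵ pt ⟶ right`, as a bare triple. -/
@[ext]
structure BareSpan {K : Type u} [Bicategory.{w, v} K] (x y : K) where
  pt : K
  fst : pt ⟶ x
  snd : pt ⟶ y

/-- A singleton strict pretopology on a 2-category `K`: a class of 1-arrows containing the
identities, closed under composition, with a specified strict pullback of each of its elements
`l : v ⟶ y` along each 1-arrow `f : u ⟶ y`, the projection to `u` being again in the class.
The specified pullback of `l` along `f` is `f` itself when `l` is an identity, and is `l` itself
when `f` is an identity. -/
structure StrictPretopology (K : Type u) [Bicategory.{w, v} K] [Bicategory.Strict K] where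
  /-- The class of 1-arrows (the covers). -/
  cover : ∀ ⦃x y : K⦄, (x ⟶ y) → Prop
  id_cover : ∀ x : K, cover (𝟙 x)
  comp_cover : ∀ {x y z : K} (f : x ⟶ y) (g : y ⟶ z), cover f → cover g → cover (f ≫ g)
  /-- The specified pullback `u ×_y v`, with its two projections. -/
  pb : ∀ {u v y : K} (f : u ⟶ y) (l : v ⟶ y), cover l → BareSpan u v
  isPullback : ∀ {u v y : K} (f : u ⟶ y) (l : v ⟶ y) (hl : cover l),
    IsPullback (pb f l hl).fst (pb f l hl).snd f l
  pb_fst_cover : ∀ {u v y : K} (f : u ⟶ y) (l : v ⟶ y) (hl : cover l), cover (pb f l hl).fst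
  pb_of_id : ∀ {u y : K} (f : u ⟶ y), pb f (𝟙 y) (id_cover y) = ⟨u, 𝟙 u, f⟩
  pb_along_id : ∀ {v y : K} (l : v ⟶ y) (hl : cover l), pb (𝟙 y) l hl = ⟨v, l, 𝟙 v⟩

namespace StrictPretopology

variable {K : Type u} [Bicategory.{w, v} K] [Bicategory.Strict K] (J : StrictPretopology K)

/-- The 1-arrow into a specified pullback given by its universal property. -/
def lift {a b y t : K} (f : a ⟶ y) (l : b ⟶ y) (hl : J.cover l) (p : t ⟶ a) (q : t ⟶ b)
    (h : p ≫ f = q ≫ l) : t ⟶ (J.pb f l hl).pt :=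
  (J.isPullback f l hl).lift p q h

theorem lift_fst {a b y t : K} (f : a ⟶ y) (l : b ⟶ y) (hl : J.cover l) (p : t ⟶ a)
    (q : t ⟶ b) (h : p ≫ f = q ≫ l) : J.lift f l hl p q h ≫ (J.pb f l hl).fst = p :=
  (J.isPullback f l hl).lift_fst p q h

theorem lift_snd {a b y t : K} (f : a ⟶ y) (l : b ⟶ y) (hl : J.cover l) (p : t ⟶ a)
    (q : t ⟶ b) (h : p ≫ f = q ≫ l) : J.lift f l hl p q h ≫ (J.pb f l hl).snd = q :=
  (J.isPullback f l hl).lift_snd p q h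

theorem condition {a b y : K} (f : a ⟶ y) (l : b ⟶ y) (hl : J.cover l) :
    (J.pb f l hl).fst ≫ f = (J.pb f l hl).snd ≫ l :=
  (J.isPullback f l hl).w

/-- `J` is contained in the class of ff 1-arrows. -/
def ContainedInFF : Prop :=
  ∀ ⦃x y : K⦄ (j : x ⟶ y), J.cover j → IsFF j

/-- For a cover `p : a ⟶ x` and 1-arrows `f g : x ⟶ y`, the strict descent condition on a
2-arrow `α : p ≫ f ⟶ p ≫ g`: its whiskerings with the two projections `a ×_x a ⟶ a` agree.
The `eqToHom`s are the equalities of sources and of targets. -/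
def IsDescentDatum {a x y : K} (p : a ⟶ x) (hp : J.cover p) (f g : x ⟶ y)
    (α : p ≫ f ⟶ p ≫ g) : Prop :=
  (J.pb p p hp).fst ◁ α =
    eqToHom (by rw [← Category.assoc, ← Category.assoc, J.condition]) ≫
      (J.pb p p hp).snd ◁ α ≫
        eqToHom (by rw [← Category.assoc, ← Category.assoc, J.condition])

/-- `J` is totally strict subcanonical: for every cover `p : a ⟶ x` and every `y`, precomposition
with `p` is a fully faithful functor from `K(x, y)` to strict descent data. -/
def Subcanonical : Prop :=
  ∀ ⦃a x : K⦄ (p : a ⟶ x) (hp : J.cover p) ⦃y : K⦄ (f g : x ⟶ y) (α : p ≫ f ⟶ p ≫ g),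
    J.IsDescentDatum p hp f g α → ∃! β : f ⟶ g, p ◁ β = α

/-! ### Fractions and their maps -/

/-- A `J`-fraction `x ⟵ pt ⟶ y`, the left leg being in `J`. -/
structure Fraction (x y : K) where
  pt : K
  left : pt ⟶ x
  left_cover : J.cover left
  right : pt ⟶ y

variable {J}

namespace Fraction

/-- The identity fraction. -/
abbrev id (J : StrictPretopology K) (x : K) : J.Fraction x x :=
  ⟨x, 𝟙 x, J.id_cover x, 𝟙 x⟩

/-- The fraction `u ⟵ u ×_y v ⟶ z`, for a 1-arrow `f : u ⟶ y` and a fraction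
`y ⟵ v ⟶ z`. -/
abbrev pullback {a y z : K} (f : a ⟶ y) (G : J.Fraction y z) : J.Fraction a z where
  pt := (J.pb f G.left G.left_cover).pt
  left := (J.pb f G.left G.left_cover).fst
  left_cover := J.pb_fst_cover _ _ _
  right := (J.pb f G.left G.left_cover).snd ≫ G.right

/-- The fraction `x ⟵ u ⟵ v ⟶ z`, for a cover `j : u ⟶ x` and a fraction `u ⟵ v ⟶ z`. -/
abbrev push {a x z : K} (j : a ⟶ x) (hj : J.cover j) (G : J.Fraction a z) : J.Fraction x z where
  pt := G.pt
  left := G.left ≫ j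
  left_cover := J.comp_cover _ _ G.left_cover hj
  right := G.right

/-- Composition of fractions: the composite span `x ⟵ u ⟵ u ×_y v ⟶ v ⟶ z`. -/
abbrev comp {x y z : K} (F : J.Fraction x y) (G : J.Fraction y z) : J.Fraction x z :=
  push F.left F.left_cover (pullback F.right G)

/-- The pullback `u ×_x v` of the left legs of two fractions with the same source. -/
abbrev meet {x y y' : K} (F : J.Fraction x y) (G : J.Fraction x y') : BareSpan F.pt G.pt :=
  J.pb F.left G.left G.left_cover

end Fraction

/-- A map of `J`-fractions `(j, f) ⟶ (k, g)`: a 2-arrow from `u ×_x v ⟶ u ⟶ y` to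
`u ×_x v ⟶ v ⟶ y`. -/
@[ext]
structure FractionMap {x y : K} (F G : J.Fraction x y) where
  cell : (F.meet G).fst ≫ F.right ⟶ (F.meet G).snd ≫ G.right

/-! ### Renaming maps -/

/-- The unique lift through an ff 1-arrow `l` of a 2-arrow `g ≫ l ⟶ h ≫ l`. -/
def _root_.IsFF.lift {x y z : K} {l : x ⟶ y} (hl : IsFF l) {g h : z ⟶ x}
    (α : g ≫ l ⟶ h ≫ l) : g ⟶ h :=
  (hl g h α).choose

/-- The canonical 2-arrow between two lifts `g`, `h` of one 1-arrow through an ff 1-arrow `l`. -/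
def _root_.IsFF.canonical {x y z : K} {l : x ⟶ y} (hl : IsFF l) {g h : z ⟶ x}
    (e : g ≫ l = h ≫ l) : g ⟶ h :=
  hl.lift (eqToHom e)

/-- A renaming map from `(j, f)` to `(k, g)`: a 1-arrow `r` with `j = k ∘ r` and a 2-arrow
from `f` to `g ∘ r`. -/
structure RenamingMap {x y : K} (F G : J.Fraction x y) where
  arrow : F.pt ⟶ G.pt
  arrow_left : arrow ≫ G.left = F.left
  cell : F.right ⟶ arrow ≫ G.right

/-- The identity renaming map. -/
def RenamingMap.id {x y : K} (F : J.Fraction x y) : RenamingMap F F where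
  arrow := 𝟙 F.pt
  arrow_left := Category.id_comp _
  cell := eqToHom (Category.id_comp _).symm

/-- The map of fractions `ι(r)` associated with a renaming map `r`. -/
def RenamingMap.toMap (hff : J.ContainedInFF) {x y : K} {F G : J.Fraction x y}
    (r : RenamingMap F G) : FractionMap F G where
  cell :=
    (F.meet G).fst ◁ r.cell ≫
      eqToHom (Category.assoc _ _ _).symm ≫
        (hff _ G.left_cover).canonical
          (g := (F.meet G).fst ≫ r.arrow) (h := (F.meet G).snd)
          (by rw [Category.assoc, r.arrow_left]; exact J.condition _ _ _) ▷ G.right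

/-! ### Vertical composition -/

section Vertical

variable {x y : K} (F G H : J.Fraction x y)

/-- The triple pullback `(u₁ ×_x u₂) ×_x u₃`. -/
abbrev triple : BareSpan (F.meet G).pt H.pt :=
  J.pb ((F.meet G).fst ≫ F.left) H.left H.left_cover

/-- The projection `u₁ ×_x u₂ ×_x u₃ ⟶ u₁ ×_x u₂`. -/
abbrev pr₁₂ : (triple F G H).pt ⟶ (F.meet G).pt := (triple F G H).fst

/-- The projection `u₁ ×_x u₂ ×_x u₃ ⟶ u₂ ×_x u₃`. -/
def pr₂₃ : (triple F G H).pt ⟶ (G.meet H).pt :=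
  J.lift G.left H.left H.left_cover (pr₁₂ F G H ≫ (F.meet G).snd) (triple F G H).snd (by
    rw [Category.assoc, ← J.condition F.left G.left G.left_cover]
    exact J.condition _ _ _)

/-- The projection `u₁ ×_x u₂ ×_x u₃ ⟶ u₁ ×_x u₃`. -/
def pr₁₃ : (triple F G H).pt ⟶ (F.meet H).pt :=
  J.lift F.left H.left H.left_cover (pr₁₂ F G H ≫ (F.meet G).fst) (triple F G H).snd (by
    rw [Category.assoc]
    exact J.condition _ _ _)

theorem pr₁₃_fst : pr₁₃ F G H ≫ (F.meet H).fst = pr₁₂ F G H ≫ (F.meet G).fst :=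
  J.lift_fst _ _ _ _ _ _

theorem pr₁₃_snd : pr₁₃ F G H ≫ (F.meet H).snd = pr₂₃ F G H ≫ (G.meet H).snd :=
  (J.lift_snd _ _ _ _ _ _).trans (J.lift_snd _ _ _ _ _ _).symm

theorem pr₁₂_snd : pr₁₂ F G H ≫ (F.meet G).snd = pr₂₃ F G H ≫ (G.meet H).fst :=
  (J.lift_fst _ _ _ _ _ _).symm

variable {F G H}

/-- The precomposition `t₁ ⊕ t₂`: the 2-arrow on `u₁ ×_x u₂ ×_x u₃` obtained by pasting `t₁`
and `t₂` (its source and target are written as factoring through `pr₁₃`). -/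
def precomp (t₁ : FractionMap F G) (t₂ : FractionMap G H) :
    pr₁₃ F G H ≫ (F.meet H).fst ≫ F.right ⟶ pr₁₃ F G H ≫ (F.meet H).snd ≫ H.right :=
  eqToHom (by rw [← Category.assoc, pr₁₃_fst, Category.assoc]) ≫
    pr₁₂ F G H ◁ t₁.cell ≫
      eqToHom (by rw [← Category.assoc, pr₁₂_snd, Category.assoc]) ≫
        pr₂₃ F G H ◁ t₂.cell ≫
          eqToHom (by rw [← Category.assoc, ← pr₁₃_snd, Category.assoc])

/-- `s` is a vertical composite of `t₁` and `t₂`: it is a descent of `t₁ ⊕ t₂` along `pr₁₃`. -/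
def IsVerticalComp (t₁ : FractionMap F G) (t₂ : FractionMap G H) (s : FractionMap F H) : Prop :=
  pr₁₃ F G H ◁ s.cell = precomp t₁ t₂

end Vertical

/-! ### Right whiskering -/

section RightWhisker

variable {x y z : K} {F G : J.Fraction x y}

/-- The canonical 1-arrow `(u ×_y w) ×_x (v ×_y w) ⟶ u ×_x v`. -/
def rightWhiskerBase (F G : J.Fraction x y) (L : J.Fraction y z) :
    ((F.comp L).meet (G.comp L)).pt ⟶ (F.meet G).pt :=
  J.lift F.left G.left G.left_cover
    (((F.comp L).meet (G.comp L)).fst ≫ (J.pb F.right L.left L.left_cover).fst)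
    (((F.comp L).meet (G.comp L)).snd ≫ (J.pb G.right L.left L.left_cover).fst) (by
      rw [Category.assoc, Category.assoc]
      exact J.condition (F.comp L).left (G.comp L).left (G.comp L).left_cover)

/-- The 2-arrow `ρ` between the two projections `(u ×_y w) ×_x (v ×_y w) ⟶ w`: the unique lift
through `w ⟶ y` of the restriction of `t`. -/
def rightWhiskerCell (hff : J.ContainedInFF) (t : FractionMap F G) (L : J.Fraction y z) :
    ((F.comp L).meet (G.comp L)).fst ≫ (J.pb F.right L.left L.left_cover).snd ⟶
      ((F.comp L).meet (G.comp L)).snd ≫ (J.pb G.right L.left L.left_cover).snd :=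
  (hff _ L.left_cover).lift
    (eqToHom (by
        rw [Category.assoc, ← J.condition F.right L.left L.left_cover, ← Category.assoc,
          ← Category.assoc]
        congr 1
        exact (J.lift_fst _ _ _ _ _ _).symm) ≫
      rightWhiskerBase F G L ◁ t.cell ≫
        eqToHom (by
          rw [Category.assoc, ← J.condition G.right L.left L.left_cover, ← Category.assoc,
            ← Category.assoc]
          congr 1
          exact J.lift_snd _ _ _ _ _ _))

/-- Right whiskering of the map of fractions `t` by the fraction `y ⟵ w ⟶ z`. -/
def rightWhisker (hff : J.ContainedInFF) (t : FractionMap F G) (L : J.Fraction y z) :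
    FractionMap (F.comp L) (G.comp L) where
  cell :=
    eqToHom (Category.assoc _ _ _).symm ≫ rightWhiskerCell hff t L ▷ L.right ≫
      eqToHom (Category.assoc _ _ _)

end RightWhisker

/-! ### Left whiskering -/

section LeftWhisker

/-- The canonical 1-arrow `(u ×_y v₁) ×_u (u ×_y v₂) ⟶ v₁ ×_y v₂`. -/
def leftWhiskerBase {a y z : K} (f : a ⟶ y) (G H : J.Fraction y z) :
    ((G.pullback f).meet (H.pullback f)).pt ⟶ (G.meet H).pt :=
  J.lift G.left H.left H.left_cover
    (((G.pullback f).meet (H.pullback f)).fst ≫ (J.pb f G.left G.left_cover).snd)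
    (((G.pullback f).meet (H.pullback f)).snd ≫ (J.pb f H.left H.left_cover).snd) (by
      rw [Category.assoc, Category.assoc, ← J.condition f G.left G.left_cover,
        ← J.condition f H.left H.left_cover, ← Category.assoc, ← Category.assoc]
      congr 1
      exact J.condition (G.pullback f).left (H.pullback f).left (H.pullback f).left_cover)

/-- Left whiskering, case I: whiskering of `t` by `u ⟵ u ⟶ y` (left leg the identity), given by
restricting the 2-arrow `t` along `(u ×_y v₁) ×_u (u ×_y v₂) ⟶ v₁ ×_y v₂`. -/
def leftWhiskerI {a y z : K} (f : a ⟶ y) {G H : J.Fraction y z} (t : FractionMap G H) :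
    FractionMap (G.pullback f) (H.pullback f) where
  cell :=
    eqToHom (by
        rw [← Category.assoc (leftWhiskerBase f G H)]
        rw [← Category.assoc]
        congr 1
        exact (J.lift_fst _ _ _ _ _ _).symm) ≫
      leftWhiskerBase f G H ◁ t.cell ≫
        eqToHom (by
          rw [← Category.assoc (leftWhiskerBase f G H)]
          rw [← Category.assoc]
          congr 1
          exact J.lift_snd _ _ _ _ _ _)

variable {a x z : K} (j : a ⟶ x) (hj : J.cover j) (G H : J.Fraction a z)

/-- `V₁₂ = v₁ ×_x v₂`. -/
abbrev bigMeet : BareSpan G.pt H.pt := (G.push j hj).meet (H.push j hj)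

/-- The 1-arrow `V₁₂ ⟶ x`. -/
abbrev bigMeetLeft : (bigMeet j hj G H).pt ⟶ x := (bigMeet j hj G H).fst ≫ G.left ≫ j

theorem bigMeetLeft_cover : J.cover (bigMeetLeft j hj G H) :=
  J.comp_cover _ _ (J.pb_fst_cover _ _ _) (J.comp_cover _ _ G.left_cover hj)

/-- The canonical 1-arrow `v₁₂ = v₁ ×_u v₂ ⟶ V₁₂`. -/
def meetToBigMeet : (G.meet H).pt ⟶ (bigMeet j hj G H).pt :=
  J.lift (G.left ≫ j) (H.left ≫ j) (H.push j hj).left_cover (G.meet H).fst (G.meet H).snd (by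
    rw [← Category.assoc, J.condition G.left H.left H.left_cover, Category.assoc])

theorem meetToBigMeet_fst :
    meetToBigMeet j hj G H ≫ (bigMeet j hj G H).fst = (G.meet H).fst :=
  J.lift_fst _ _ _ _ _ _

theorem meetToBigMeet_snd :
    meetToBigMeet j hj G H ≫ (bigMeet j hj G H).snd = (G.meet H).snd :=
  J.lift_snd _ _ _ _ _ _

/-- The pullback `v₁₂ ×_x V₁₂`. -/
abbrev caseIIPb : BareSpan (G.meet H).pt (bigMeet j hj G H).pt :=
  J.pb (meetToBigMeet j hj G H ≫ bigMeetLeft j hj G H) (bigMeetLeft j hj G H)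
    (bigMeetLeft_cover j hj G H)

theorem caseIIPb_condition :
    ((caseIIPb j hj G H).fst ≫ meetToBigMeet j hj G H) ≫ bigMeetLeft j hj G H =
      (caseIIPb j hj G H).snd ≫ bigMeetLeft j hj G H := by
  rw [Category.assoc]
  exact J.condition _ _ _

variable {G H}

/-- Left whiskering, case II: `s` is a whiskering of `t` by `x ⟵ u ⟶ u` (left leg `j`, right leg
the identity). That is, the restriction of `s` along `pr₂ : v₁₂ ×_x V₁₂ ⟶ V₁₂` is the
pasting of the canonical 2-arrow from `pr₂` to `v₁₂ ×_x V₁₂ ⟶ v₁₂ ⟶ V₁₂`, of `t`, and of the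
canonical 2-arrow back to `pr₂`; so `s` is a descent of this pasting along `pr₂`. -/
def IsLeftWhiskerII (hff : J.ContainedInFF) (t : FractionMap G H)
    (s : FractionMap (G.push j hj) (H.push j hj)) : Prop :=
  (caseIIPb j hj G H).snd ◁ s.cell =
    (hff _ (bigMeetLeft_cover j hj G H)).canonical (caseIIPb_condition j hj G H).symm ▷
        ((bigMeet j hj G H).fst ≫ G.right) ≫
      eqToHom (by
        rw [Category.assoc, ← Category.assoc (meetToBigMeet j hj G H), meetToBigMeet_fst]) ≫
      (caseIIPb j hj G H).fst ◁ t.cell ≫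
      eqToHom (by
        rw [Category.assoc, ← Category.assoc (meetToBigMeet j hj G H), meetToBigMeet_snd]) ≫
      (hff _ (bigMeetLeft_cover j hj G H)).canonical (caseIIPb_condition j hj G H) ▷
        ((bigMeet j hj G H).snd ≫ H.right)

/-- Left whiskering by a general fraction `(j, f)`: case I for `f` followed by case II for `j`. -/
def IsLeftWhisker (hff : J.ContainedInFF) {y : K} (F : J.Fraction x y) {G H : J.Fraction y z}
    (t : FractionMap G H) (s : FractionMap (F.comp G) (F.comp H)) : Prop :=
  IsLeftWhiskerII F.left F.left_cover hff (leftWhiskerI F.right t) s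

end LeftWhisker

/-! ### Associator -/

section Associator

variable {x₁ x₂ x₃ x₄ : K} (F : J.Fraction x₁ x₂) (G : J.Fraction x₂ x₃) (H : J.Fraction x₃ x₄)

/-- The canonical 1-arrow `(u ×_{x₂} v) ×_{x₃} w ⟶ v ×_{x₃} w`. -/
def assocArrowSnd : ((F.comp G).comp H).pt ⟶ (G.comp H).pt :=
  J.lift G.right H.left H.left_cover
    ((J.pb (F.comp G).right H.left H.left_cover).fst ≫ (J.pb F.right G.left G.left_cover).snd)
    (J.pb (F.comp G).right H.left H.left_cover).snd (by
      rw [Category.assoc]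
      exact J.condition (F.comp G).right H.left H.left_cover)

/-- The canonical 1-arrow `(u ×_{x₂} v) ×_{x₃} w ⟶ u ×_{x₂} (v ×_{x₃} w)`. -/
def assocArrow : ((F.comp G).comp H).pt ⟶ (F.comp (G.comp H)).pt :=
  J.lift F.right (G.comp H).left (G.comp H).left_cover
    ((J.pb (F.comp G).right H.left H.left_cover).fst ≫ (J.pb F.right G.left G.left_cover).fst)
    (assocArrowSnd F G H) (by
      have h₁ : assocArrowSnd F G H ≫ (J.pb G.right H.left H.left_cover).fst =
          (J.pb (F.comp G).right H.left H.left_cover).fst ≫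
            (J.pb F.right G.left G.left_cover).snd := J.lift_fst _ _ _ _ _ _
      change _ = _ ≫ (J.pb G.right H.left H.left_cover).fst ≫ G.left
      rw [← Category.assoc, h₁, Category.assoc, Category.assoc, J.condition])

theorem assocArrow_left :
    assocArrow F G H ≫ (F.comp (G.comp H)).left = ((F.comp G).comp H).left := by
  change _ ≫ (J.pb F.right (G.comp H).left (G.comp H).left_cover).fst ≫ F.left =
    (J.pb (F.comp G).right H.left H.left_cover).fst ≫
      (J.pb F.right G.left G.left_cover).fst ≫ F.left
  rw [← Category.assoc, ← Category.assoc]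
  congr 1
  exact J.lift_fst _ _ _ _ _ _

theorem assocArrow_right :
    ((F.comp G).comp H).right = assocArrow F G H ≫ (F.comp (G.comp H)).right := by
  change (J.pb (F.comp G).right H.left H.left_cover).snd ≫ H.right =
    _ ≫ (J.pb F.right (G.comp H).left (G.comp H).left_cover).snd ≫
      (J.pb G.right H.left H.left_cover).snd ≫ H.right
  rw [← Category.assoc, ← Category.assoc]
  congr 1
  have h₁ : assocArrow F G H ≫ (J.pb F.right (G.comp H).left (G.comp H).left_cover).snd =
      assocArrowSnd F G H := J.lift_snd _ _ _ _ _ _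
  rw [h₁]
  exact (J.lift_snd _ _ _ _ _ _).symm

/-- The renaming map underlying the associator: the canonical 1-arrow and the identity
2-arrow. -/
def assocRenaming : RenamingMap ((F.comp G).comp H) (F.comp (G.comp H)) where
  arrow := assocArrow F G H
  arrow_left := assocArrow_left F G H
  cell := eqToHom (assocArrow_right F G H)

end Associator

end StrictPretopology

/-! ### Bicategories with prescribed operations -/

/-- The operations of a bicategory other than the unitors, without any laws. The associator is
recorded through its underlying 2-arrow. -/
structure BicategoryOperations (B : Type u) extends CategoryStruct.{v} B where
  homStruct : ∀ a b : B, CategoryStruct.{w} (a ⟶ b)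
  whiskerLeft : ∀ {a b c : B} (f : a ⟶ b) {g h : b ⟶ c}, (g ⟶ h) → (f ≫ g ⟶ f ≫ h)
  whiskerRight : ∀ {a b c : B} {f g : a ⟶ b}, (f ⟶ g) → ∀ h : b ⟶ c, f ≫ h ⟶ g ≫ h
  associator : ∀ {a b c d : B} (f : a ⟶ b) (g : b ⟶ c) (h : c ⟶ d), (f ≫ g) ≫ h ⟶ f ≫ g ≫ h

/-- The operations of a bicategory. -/
def CategoryTheory.Bicategory.operations {B : Type u} (hB : Bicategory.{w, v} B) :
    BicategoryOperations.{w, v} B where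
  toCategoryStruct := hB.toCategoryStruct
  homStruct a b := (hB.homCategory a b).toCategoryStruct
  whiskerLeft f _ _ η := hB.whiskerLeft f η
  whiskerRight η h := hB.whiskerRight η h
  associator f g h := (hB.associator f g h).hom

/-- A bicategory is strictly unital if composition with identity 1-arrows changes nothing and the
unitors are the identities given by these equalities. -/
def CategoryTheory.Bicategory.StrictlyUnital {B : Type u} (_ : Bicategory.{w, v} B) : Prop :=
  ∀ {a b : B} (f : a ⟶ b),
    (∃ h : 𝟙 a ≫ f = f, λ_ f = eqToIso h) ∧ (∃ h : f ≫ 𝟙 b = f, ρ_ f = eqToIso h)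

namespace StrictPretopology

variable {K : Type u} [Bicategory.{w, v} K] [Bicategory.Strict K] (J : StrictPretopology K)

/-- The objects of `K_J`: the objects of `K`. -/
def FractionBicat (_ : StrictPretopology K) : Type u := K

/-- An operation with the type of vertical composition of maps of fractions. -/
abbrev VComp : Type (max u v w) :=
  ∀ {x y : K} {F G H : J.Fraction x y}, FractionMap F G → FractionMap G H → FractionMap F H

/-- An operation with the type of left whiskering of maps of fractions. -/
abbrev LWhisker : Type (max u v w) :=
  ∀ {x y z : K} (F : J.Fraction x y) {G H : J.Fraction y z},
    FractionMap G H → FractionMap (F.comp G) (F.comp H)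

/-- The operations of `K_J`, for a given vertical composition and left whiskering: fractions as
1-arrows, maps of fractions as 2-arrows, the identity map `ι(id)`, right whiskering, and the
associator `ι(a)` for `a` the associativity renaming map. -/
def operations (hff : J.ContainedInFF) (vcomp : J.VComp) (lwhisker : J.LWhisker) :
    BicategoryOperations.{w, max u v} J.FractionBicat where
  Hom x y := J.Fraction (x : K) y
  id x := Fraction.id J x
  comp F G := Fraction.comp F G
  homStruct _ _ :=
    { Hom := fun F G => FractionMap F G
      id := fun F => (RenamingMap.id F).toMap hff
      comp := fun t₁ t₂ => vcomp t₁ t₂ }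
  whiskerLeft F _ _ t := lwhisker F t
  whiskerRight t L := rightWhisker hff t L
  associator F G H := (assocRenaming F G H).toMap hff

end StrictPretopology

end

/-! A map of fractions `t` from (j, f) to (k, g) is handled through its values. For lifts p, q of
one 1-arrow T → x through j and k, restricting the 2-arrow of `t` along (p, q) : T → u ×_x v gives
`t.app p q`, from f p to g q. Values are stable under restriction. They are also natural for
2-arrows between lifts that agree over x (`app_naturality`): u ×_x v → x is a cover, hence ff, so
such 2-arrows lift to u ×_x v, and the interchange law of K applies there.

The main point is `app_existsUnique`: if T → x is a cover, evaluation at (p, q) is a bijection from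
maps of fractions to 2-arrows f p ⇒ g q. Let W be the pullback of T → x along u ×_x v → x.
Conjugating a given 2-arrow by canonical ones yields a 2-arrow on W, which descends to u ×_x v. The
descent condition is automatic (`conj_eq_conj`): two 1-arrows into T with equal composites to x are
joined by a canonical 2-arrow, since T → x is ff, and the conjugation absorbs it. Uniqueness holds
because values on W are determined by the value at (p, q), and whiskering along a cover is
injective.

All descents in the definition of K_J are of this kind, so the operations can be computed on values.
Vertical composition composes them (`vcomp_app`). Left whiskering keeps them when the first
components agree (`lwhisker_app`). Right whiskering lifts them through l and applies h
(`rightWhisker_app`). Each bicategory law is then tested on one cover of x on which all the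
necessary lifts exist (`exists_lifts`). There associators and unitors have identity values, and what
remains is a law of K, or naturality of values in the case of interchange. -/

noncomputable section

/-! ### Transport of 2-arrows along equalities of 1-arrows -/

section Recast

variable {K : Type u} [Bicategory.{w, v} K]

/-- A 2-arrow with its source and target replaced by equal 1-arrows. -/
def recast {a b : K} {f g m n : a ⟶ b} (γ : f ⟶ g) (hm : m = f) (hn : n = g) : m ⟶ n :=
  eqToHom hm ≫ γ ≫ eqToHom hn.symm

variable {a b c d : K}

@[simp]
theorem recast_rfl {f g : a ⟶ b} (γ : f ⟶ g) (h : f = f) (h' : g = g) : recast γ h h' = γ := by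
  simp [recast]

@[simp]
theorem recast_recast {f g m n m' n' : a ⟶ b} (γ : f ⟶ g) (hm : m = f) (hn : n = g)
    (hm' : m' = m) (hn' : n' = n) :
    recast (recast γ hm hn) hm' hn' = recast γ (hm'.trans hm) (hn'.trans hn) := by
  subst hm hn hm' hn'; simp

@[simp]
theorem recast_eqToHom {f g m n : a ⟶ b} (e : f = g) (hm : m = f) (hn : n = g) :
    recast (eqToHom e) hm hn = eqToHom (hm.trans (e.trans hn.symm)) := by
  subst e hm hn; simp

@[simp]
theorem recast_comp_recast {f g h m k n : a ⟶ b} (γ : f ⟶ g) (δ : g ⟶ h) (hm : m = f)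
    (hk hk' : k = g) (hn : n = h) :
    recast γ hm hk ≫ recast δ hk' hn = recast (γ ≫ δ) hm hn := by
  subst hm hk hn; simp

theorem eqToHom_comp_eq_recast {f g m : a ⟶ b} (hm : m = f) (γ : f ⟶ g) :
    eqToHom hm ≫ γ = recast γ hm rfl := by
  subst hm; simp

theorem comp_eqToHom_eq_recast {f g n : a ⟶ b} (γ : f ⟶ g) (hn : g = n) :
    γ ≫ eqToHom hn = recast γ rfl hn.symm := by
  subst hn; simp

theorem eqToHom_comp_comp_eqToHom_comp {f g h m n : a ⟶ b} (hm : m = f) (γ : f ⟶ g) (hn : g = n)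
    (δ : n ⟶ h) : eqToHom hm ≫ γ ≫ eqToHom hn ≫ δ = recast γ hm hn.symm ≫ δ := by
  subst hm hn; simp

theorem recast_inj {f g m n : a ⟶ b} {γ δ : f ⟶ g} (hm : m = f) (hn : n = g) :
    recast γ hm hn = recast δ hm hn ↔ γ = δ := by
  subst hm hn; simp

theorem eq_recast_iff {f g m n : a ⟶ b} {γ : f ⟶ g} {δ : m ⟶ n} (hm : m = f) (hn : n = g) :
    δ = recast γ hm hn ↔ recast δ hm.symm hn.symm = γ := by
  subst hm hn; simp

@[simp]
theorem whiskerLeft_recast (r : c ⟶ a) {f g m n : a ⟶ b} (γ : f ⟶ g) (hm : m = f) (hn : n = g) :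
    r ◁ recast γ hm hn = recast (r ◁ γ) (congrArg (r ≫ ·) hm) (congrArg (r ≫ ·) hn) := by
  subst hm hn; simp

@[simp]
theorem recast_whiskerRight {f g m n : a ⟶ b} (γ : f ⟶ g) (hm : m = f) (hn : n = g)
    (r : b ⟶ c) :
    recast γ hm hn ▷ r = recast (γ ▷ r) (congrArg (· ≫ r) hm) (congrArg (· ≫ r) hn) := by
  subst hm hn; simp

theorem whiskerLeft_eq_of_eq {r r' : c ⟶ a} (h : r = r') {f g : a ⟶ b} (γ : f ⟶ g) :
    r ◁ γ = recast (r' ◁ γ) (congrArg (· ≫ f) h) (congrArg (· ≫ g) h) := by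
  subst h; simp

theorem whiskerRight_eq_of_eq {r r' : b ⟶ c} (h : r = r') {f g : a ⟶ b} (γ : f ⟶ g) :
    γ ▷ r = recast (γ ▷ r') (congrArg (f ≫ ·) h) (congrArg (g ≫ ·) h) := by
  subst h; simp

variable [Bicategory.Strict K]

/-- Associators of a strict 2-category are `eqToHom`s, so the laws of whiskering become transports.
The associativity laws are given in both directions for rewriting. -/
theorem comp_whiskerLeft_eq (p : a ⟶ b) (q : b ⟶ c) {f g : c ⟶ d} (γ : f ⟶ g) :
    (p ≫ q) ◁ γ = recast (p ◁ q ◁ γ) (Category.assoc _ _ _) (Category.assoc _ _ _) := by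
  simp [recast, Strict.associator_eqToIso]

theorem whiskerRight_comp_eq {f g : a ⟶ b} (γ : f ⟶ g) (p : b ⟶ c) (q : c ⟶ d) :
    γ ▷ (p ≫ q) =
      recast (γ ▷ p ▷ q) (Category.assoc _ _ _).symm (Category.assoc _ _ _).symm := by
  simp [recast, Strict.associator_eqToIso]

theorem whiskerLeft_whiskerLeft_eq (p : a ⟶ b) (q : b ⟶ c) {f g : c ⟶ d} (γ : f ⟶ g) :
    p ◁ q ◁ γ =
      recast ((p ≫ q) ◁ γ) (Category.assoc _ _ _).symm (Category.assoc _ _ _).symm := by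
  rw [comp_whiskerLeft_eq, recast_recast, recast_rfl]

theorem whiskerRight_whiskerRight_eq {f g : a ⟶ b} (γ : f ⟶ g) (p : b ⟶ c) (q : c ⟶ d) :
    γ ▷ p ▷ q = recast (γ ▷ (p ≫ q)) (Category.assoc _ _ _) (Category.assoc _ _ _) := by
  rw [whiskerRight_comp_eq, recast_recast, recast_rfl]

theorem whiskerLeft_whiskerRight_eq (p : a ⟶ b) {f g : b ⟶ c} (γ : f ⟶ g) (q : c ⟶ d) :
    (p ◁ γ) ▷ q = recast (p ◁ γ ▷ q) (Category.assoc _ _ _) (Category.assoc _ _ _) := by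
  simp [recast, Strict.associator_eqToIso]

theorem whiskerLeft_whiskerRight_eq_symm (p : a ⟶ b) {f g : b ⟶ c} (γ : f ⟶ g) (q : c ⟶ d) :
    p ◁ γ ▷ q =
      recast ((p ◁ γ) ▷ q) (Category.assoc _ _ _).symm (Category.assoc _ _ _).symm := by
  rw [whiskerLeft_whiskerRight_eq, recast_recast, recast_rfl]

theorem id_whiskerLeft_eq {f g : a ⟶ b} (γ : f ⟶ g) :
    𝟙 a ◁ γ = recast γ (Category.id_comp _) (Category.id_comp _) := by
  simp [recast, Strict.leftUnitor_eqToIso]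

end Recast

/-! ### Lifting 2-arrows through ff 1-arrows -/

namespace IsFF

variable {K : Type u} [Bicategory.{w, v} K] {x y z : K} {l : x ⟶ y} (hl : IsFF l)
include hl

theorem ext {g h : z ⟶ x} {γ δ : g ⟶ h} (e : γ ▷ l = δ ▷ l) : γ = δ :=
  (hl g h _).unique e rfl

theorem lift_whiskerRight {g h : z ⟶ x} (α : g ≫ l ⟶ h ≫ l) : hl.lift α ▷ l = α :=
  (hl g h α).choose_spec.1

theorem canonical_whiskerRight {g h : z ⟶ x} (e : g ≫ l = h ≫ l) :
    hl.canonical e ▷ l = eqToHom e :=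
  hl.lift_whiskerRight _

/-- The faithful half of ff: a 2-arrow lying over an identity is the canonical one. Every identity
between canonical 2-arrows below comes from this. -/
theorem eq_canonical {g h : z ⟶ x} (e : g ≫ l = h ≫ l) {γ : g ⟶ h} (hγ : γ ▷ l = eqToHom e) :
    γ = hl.canonical e :=
  hl.ext (hγ.trans (hl.canonical_whiskerRight e).symm)

theorem canonical_of_eq {g h : z ⟶ x} (e : g = h) (e' : g ≫ l = h ≫ l) :
    hl.canonical e' = eqToHom e := by
  subst e; exact (hl.eq_canonical _ (by simp)).symm

@[simp]
theorem canonical_comp {g h k : z ⟶ x} (e : g ≫ l = h ≫ l) (e' : h ≫ l = k ≫ l) :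
    hl.canonical e ≫ hl.canonical e' = hl.canonical (e.trans e') :=
  hl.eq_canonical _ (by simp [canonical_whiskerRight])

theorem whiskerLeft_canonical [Bicategory.Strict K] {t : K} (r : t ⟶ z) {g h : z ⟶ x}
    (e : g ≫ l = h ≫ l) :
    r ◁ hl.canonical e = hl.canonical (g := r ≫ g) (h := r ≫ h) (by simp [e]) :=
  hl.eq_canonical _ (by
    rw [whiskerLeft_whiskerRight_eq, hl.canonical_whiskerRight]
    simp [recast])

end IsFF

namespace StrictPretopology

variable {K : Type u} [Bicategory.{w, v} K] [Bicategory.Strict K] {J : StrictPretopology K}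

/-- The endpoint equalities are arguments, so that rewriting meets a plain `recast`; proof
irrelevance makes this definitional. -/
theorem isDescentDatum_iff {a x y : K} (p : a ⟶ x) (hp : J.cover p) {f g : x ⟶ y}
    (α : p ≫ f ⟶ p ≫ g)
    (hf : (J.pb p p hp).fst ≫ p ≫ f = (J.pb p p hp).snd ≫ p ≫ f)
    (hg : (J.pb p p hp).fst ≫ p ≫ g = (J.pb p p hp).snd ≫ p ≫ g) :
    J.IsDescentDatum p hp f g α ↔
      (J.pb p p hp).fst ◁ α = recast ((J.pb p p hp).snd ◁ α) hf hg :=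
  Iff.rfl

theorem isDescentDatum_whiskerLeft {a x y : K} (p : a ⟶ x) (hp : J.cover p) {f g : x ⟶ y}
    (β : f ⟶ g) : J.IsDescentDatum p hp f g (p ◁ β) := by
  rw [isDescentDatum_iff _ _ _ (by simp only [← Category.assoc, J.condition])
    (by simp only [← Category.assoc, J.condition])]
  rw [whiskerLeft_whiskerLeft_eq, whiskerLeft_whiskerLeft_eq,
    whiskerLeft_eq_of_eq (J.condition p p hp), recast_recast, recast_recast]

/-- A whiskered 2-arrow is always a descent datum, so the uniqueness in subcanonicity applies to it.
-/
theorem whiskerLeft_injective (hsub : J.Subcanonical) {a x y : K} {p : a ⟶ x} (hp : J.cover p)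
    {f g : x ⟶ y} {β β' : f ⟶ g} (h : p ◁ β = p ◁ β') : β = β' :=
  (hsub p hp f g _ (isDescentDatum_whiskerLeft p hp β')).unique h rfl

theorem pb_hom_ext {a b y t : K} {f : a ⟶ y} {l : b ⟶ y} {hl : J.cover l}
    {r s : t ⟶ (J.pb f l hl).pt} (h₁ : r ≫ (J.pb f l hl).fst = s ≫ (J.pb f l hl).fst)
    (h₂ : r ≫ (J.pb f l hl).snd = s ≫ (J.pb f l hl).snd) : r = s :=
  (J.isPullback f l hl).hom_ext h₁ h₂

theorem comp_lift {a b y t s : K} (f : a ⟶ y) (l : b ⟶ y) (hl : J.cover l) (r : s ⟶ t)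
    (p : t ⟶ a) (q : t ⟶ b) (h : p ≫ f = q ≫ l) :
    r ≫ J.lift f l hl p q h =
      J.lift f l hl (r ≫ p) (r ≫ q) (by rw [Category.assoc, h, Category.assoc]) :=
  pb_hom_ext (by simp [lift_fst]) (by simp [lift_snd])

/-! ### Transition between lifts through the left leg -/

namespace Fraction

variable {x y : K} (F : J.Fraction x y) (hff : J.ContainedInFF) {T : K}

/-- The image in `y` of the canonical 2-arrow between two lifts of one 1-arrow through the left leg
of a fraction. Its source and target are given up to equality. -/
def transition {p p' : T ⟶ F.pt} (h : p ≫ F.left = p' ≫ F.left) {m m' : T ⟶ y}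
    (hm : m = p ≫ F.right) (hm' : m' = p' ≫ F.right) : m ⟶ m' :=
  recast ((hff _ F.left_cover).canonical h ▷ F.right) hm hm'

theorem transition_of_eq {p p' : T ⟶ F.pt} (e : p = p') (h : p ≫ F.left = p' ≫ F.left)
    {m m' : T ⟶ y} (hm : m = p ≫ F.right) (hm' : m' = p' ≫ F.right) :
    F.transition hff h hm hm' = eqToHom (by rw [hm, hm', e]) := by
  subst e
  rw [transition, IsFF.canonical_of_eq _ rfl, eqToHom_refl, id_whiskerRight, ← eqToHom_refl _ rfl,
    recast_eqToHom]

@[simp]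
theorem transition_self {p : T ⟶ F.pt} (h : p ≫ F.left = p ≫ F.left)
    {m : T ⟶ y} (hm hm' : m = p ≫ F.right) :
    F.transition hff h hm hm' = 𝟙 m :=
  F.transition_of_eq hff rfl h hm hm'

@[simp]
theorem transition_comp {p p' p'' : T ⟶ F.pt} (h : p ≫ F.left = p' ≫ F.left)
    (h' : p' ≫ F.left = p'' ≫ F.left) {m m' m'' : T ⟶ y} (hm : m = p ≫ F.right)
    (hm' : m' = p' ≫ F.right) (hm'' : m'' = p'' ≫ F.right) :
    F.transition hff h hm hm' ≫ F.transition hff h' hm' hm'' =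
      F.transition hff (h.trans h') hm hm'' := by
  subst hm hm' hm''
  simp [transition, ← comp_whiskerRight]

theorem whiskerLeft_transition {S : K} (r : S ⟶ T) {p p' : T ⟶ F.pt}
    (h : p ≫ F.left = p' ≫ F.left) {m m' : T ⟶ y} (hm : m = p ≫ F.right)
    (hm' : m' = p' ≫ F.right) :
    r ◁ F.transition hff h hm hm' =
      F.transition hff (p := r ≫ p) (p' := r ≫ p') (by rw [Category.assoc, h, Category.assoc])
        (by rw [hm, Category.assoc]) (by rw [hm', Category.assoc]) := by
  subst hm hm'
  rw [transition, transition, ← IsFF.whiskerLeft_canonical _ r h, whiskerLeft_whiskerRight_eq]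
  simp

/-- Bookkeeping only: reassociating the intermediate lifts does not affect a 2-arrow conjugated by
transitions. -/
theorem transition_comp_recast_comp_transition {G : J.Fraction x y} {p₁ p₂ p₂' : T ⟶ F.pt}
    {q₁ q₂ q₂' : T ⟶ G.pt} (ep : p₂ = p₂') (eq : q₂ = q₂')
    {m n k l k' l' : T ⟶ y} (β : k ⟶ l)
    (hp : p₁ ≫ F.left = p₂ ≫ F.left) (hp' : p₁ ≫ F.left = p₂' ≫ F.left)
    (hq : q₂ ≫ G.left = q₁ ≫ G.left) (hq' : q₂' ≫ G.left = q₁ ≫ G.left)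
    (hm : m = p₁ ≫ F.right) (hn : n = q₁ ≫ G.right) (hk : k = p₂' ≫ F.right)
    (hl : l = q₂' ≫ G.right) (hk' : k' = k) (hl' : l' = l) (hk'' : k' = p₂ ≫ F.right)
    (hl'' : l' = q₂ ≫ G.right) :
    F.transition hff hp hm hk'' ≫ recast β hk' hl' ≫ G.transition hff hq hl'' hn =
      F.transition hff hp' hm hk ≫ β ≫ G.transition hff hq' hl hn := by
  subst ep eq hk' hl'
  rw [recast_rfl]

/-- When d factors as D followed by the left leg, the canonical 2-arrow through d, whiskered with D,
is the canonical one through the left leg, since both have the same image in x. -/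
theorem canonical_whiskerRight_comp {S : K} {D : T ⟶ F.pt} {d : T ⟶ x} (hd : IsFF d)
    (e : D ≫ F.left = d) {A A' : S ⟶ T} (hA : A ≫ d = A' ≫ d)
    (h : (A ≫ D) ≫ F.left = (A' ≫ D) ≫ F.left) :
    hd.canonical hA ▷ (D ≫ F.right) =
      F.transition hff h (Category.assoc _ _ _).symm (Category.assoc _ _ _).symm := by
  subst e
  have : hd.canonical hA ▷ D = (hff _ F.left_cover).canonical h := by
    apply IsFF.eq_canonical
    rw [whiskerRight_whiskerRight_eq, IsFF.canonical_whiskerRight, recast_eqToHom]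
  rw [whiskerRight_comp_eq, this, transition]

end Fraction

/-! ### Evaluation of maps of fractions -/

variable {x y : K} {F G : J.Fraction x y}

/-- The value of a map of fractions `t : F ⟶ G` at two lifts `p`, `q` of one 1-arrow `T ⟶ x`
through the left legs: the restriction of `t` along `T ⟶ u ×_x v`. Its source and target are
given up to equality. -/
def FractionMap.app (t : FractionMap F G) {T : K} (p : T ⟶ F.pt) (q : T ⟶ G.pt)
    (h : p ≫ F.left = q ≫ G.left) {m n : T ⟶ y} (hm : m = p ≫ F.right)
    (hn : n = q ≫ G.right) : m ⟶ n :=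
  recast (J.lift F.left G.left G.left_cover p q h ◁ t.cell)
    (by rw [hm, ← Category.assoc, J.lift_fst]) (by rw [hn, ← Category.assoc, J.lift_snd])

namespace FractionMap

theorem recast_app (t : FractionMap F G) {T : K} (p : T ⟶ F.pt) (q : T ⟶ G.pt)
    (h : p ≫ F.left = q ≫ G.left) {m n m' n' : T ⟶ y} (hm : m = p ≫ F.right)
    (hn : n = q ≫ G.right) (hm' : m' = m) (hn' : n' = n) :
    recast (t.app p q h hm hn) hm' hn' = t.app p q h (hm'.trans hm) (hn'.trans hn) := by
  simp [app]

theorem whiskerLeft_app (t : FractionMap F G) {S T : K} (r : S ⟶ T) (p : T ⟶ F.pt)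
    (q : T ⟶ G.pt) (h : p ≫ F.left = q ≫ G.left) {m n : T ⟶ y} (hm : m = p ≫ F.right)
    (hn : n = q ≫ G.right) :
    r ◁ t.app p q h hm hn =
      t.app (r ≫ p) (r ≫ q) (by rw [Category.assoc, h, Category.assoc])
        (by rw [hm, Category.assoc]) (by rw [hn, Category.assoc]) := by
  subst hm hn
  simp only [app, whiskerLeft_recast]
  rw [whiskerLeft_whiskerLeft_eq, whiskerLeft_eq_of_eq (comp_lift _ _ _ _ _ _ h), recast_recast,
    recast_recast]

/-- The projections are the universal pair of lifts: they induce the identity of u ×_x v. -/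
theorem app_meet (t : FractionMap F G) :
    t.app (F.meet G).fst (F.meet G).snd (J.condition _ _ _) rfl rfl = t.cell := by
  have : J.lift F.left G.left G.left_cover _ _ (J.condition _ _ _) = 𝟙 _ :=
    pb_hom_ext (by simp [lift_fst]) (by simp [lift_snd])
  rw [app, whiskerLeft_eq_of_eq this, id_whiskerLeft_eq]
  simp

/-- The specified pullbacks have only a one-dimensional universal property. The missing
two-dimensional one, for pairs of 2-arrows that agree over x, comes from ffness of the covers. -/
theorem app_naturality (hff : J.ContainedInFF) (t : FractionMap F G) {T : K}
    {p p' : T ⟶ F.pt} {q q' : T ⟶ G.pt} (θ : p ⟶ p') (φ : q ⟶ q')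
    (h : p ≫ F.left = q ≫ G.left) (h' : p' ≫ F.left = q' ≫ G.left)
    (e : θ ▷ F.left = recast (φ ▷ G.left) h h') {m n m' n' : T ⟶ y}
    (hm : m = p ≫ F.right) (hn : n = q ≫ G.right) (hm' : m' = p' ≫ F.right)
    (hn' : n' = q' ≫ G.right) :
    t.app p q h hm hn ≫ recast (φ ▷ G.right) hn hn' =
      recast (θ ▷ F.right) hm hm' ≫ t.app p' q' h' hm' hn' := by
  have hd := hff _ (J.comp_cover _ _ (J.pb_fst_cover F.left G.left G.left_cover) F.left_cover)
  have e₁ : ∀ (p : T ⟶ F.pt) q h, J.lift F.left G.left G.left_cover p q h ≫ (F.meet G).fst = p :=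
    fun p q h => J.lift_fst _ _ _ p q h
  have e₂ : ∀ (p : T ⟶ F.pt) q h, J.lift F.left G.left G.left_cover p q h ≫ (F.meet G).snd = q :=
    fun p q h => J.lift_snd _ _ _ p q h
  have e₃ : ∀ (p : T ⟶ F.pt) q h, J.lift F.left G.left G.left_cover p q h ≫
      (F.meet G).fst ≫ F.left = p ≫ F.left :=
    fun p q h => by rw [← Category.assoc, e₁]
  -- `Θ` joins the two 1-arrows into u ×_x v. Faithfulness of the left legs identifies its two
  -- components with `θ` and `φ`.
  obtain ⟨Θ, hΘ, -⟩ := hd _ _ (recast (θ ▷ F.left) (e₃ p q h) (e₃ p' q' h'))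
  have h₁ : Θ ▷ (F.meet G).fst = recast θ (e₁ p q h) (e₁ p' q' h') := by
    apply (hff _ F.left_cover).ext
    rw [whiskerRight_comp_eq, ← eq_comm, eq_recast_iff] at hΘ
    rw [← hΘ]
    simp
  have h₂ : Θ ▷ (F.meet G).snd = recast φ (e₂ p q h) (e₂ p' q' h') := by
    apply (hff _ G.left_cover).ext
    rw [whiskerRight_eq_of_eq (J.condition F.left G.left G.left_cover), whiskerRight_comp_eq, e,
      recast_recast] at hΘ
    refine (recast_inj (by rw [Category.assoc, ← J.condition])
      (by rw [Category.assoc, ← J.condition])).1 (hΘ.trans ?_)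
    rw [recast_whiskerRight, recast_recast, recast_recast]
  have := whisker_exchange Θ t.cell
  rw [whiskerRight_comp_eq, whiskerRight_comp_eq, h₁, h₂] at this
  subst hm hn hm' hn'
  have := congrArg (fun γ => recast γ (m := p ≫ F.right) (n := q' ≫ G.right)
    (by rw [← Category.assoc, e₁]) (by rw [← Category.assoc, e₂])) this
  rw [← recast_comp_recast _ _ _ (by rw [← Category.assoc, e₂]) (by rw [← Category.assoc, e₂]),
    ← recast_comp_recast _ _ _ (by rw [← Category.assoc, e₁]) (by rw [← Category.assoc, e₁])]
    at this
  simpa [app] using this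


theorem app_transition (hff : J.ContainedInFF) (t : FractionMap F G) {T : K}
    {p p' : T ⟶ F.pt} {q q' : T ⟶ G.pt} (hp : p ≫ F.left = p' ≫ F.left)
    (hq : q ≫ G.left = q' ≫ G.left)
    (h : p ≫ F.left = q ≫ G.left) (h' : p' ≫ F.left = q' ≫ G.left) {m n m' n' : T ⟶ y}
    (hm : m = p ≫ F.right) (hn : n = q ≫ G.right) (hm' : m' = p' ≫ F.right)
    (hn' : n' = q' ≫ G.right) :
    t.app p q h hm hn ≫ G.transition hff hq hn hn' =
      F.transition hff hp hm hm' ≫ t.app p' q' h' hm' hn' :=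
  t.app_naturality hff _ _ h h' (by
    rw [IsFF.canonical_whiskerRight, IsFF.canonical_whiskerRight, recast_eqToHom]) _ _ _ _

/-- One value determines the values at all other lifts of 1-arrows equal over x, by conjugation with
transitions. -/
theorem app_eq_transition_comp (hff : J.ContainedInFF) (t : FractionMap F G) {T : K}
    {p p' : T ⟶ F.pt} {q q' : T ⟶ G.pt} (hp : p ≫ F.left = p' ≫ F.left)
    (hq : q' ≫ G.left = q ≫ G.left)
    (h : p ≫ F.left = q ≫ G.left) (h' : p' ≫ F.left = q' ≫ G.left) {m n m' n' : T ⟶ y}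
    (hm : m = p ≫ F.right) (hn : n = q ≫ G.right) (hm' : m' = p' ≫ F.right)
    (hn' : n' = q' ≫ G.right) :
    t.app p q h hm hn =
      F.transition hff hp hm hm' ≫ t.app p' q' h' hm' hn' ≫ G.transition hff hq hn' hn := by
  rw [← Category.assoc, ← t.app_transition hff hp hq.symm h h' hm hn hm' hn', Category.assoc,
    Fraction.transition_comp, Fraction.transition_self, Category.comp_id]

/-! ### Descent of maps of fractions -/

/-- `A` and `A'` agree over x, so ffness of T → x gives a canonical 2-arrow between them; exchange
it with `α`. This is what makes descent conditions automatic. -/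
theorem whiskerLeft_comp_transition (hff : J.ContainedInFF) {S T : K} {p : T ⟶ F.pt}
    {q : T ⟶ G.pt} (hT : J.cover (p ≫ F.left)) (hpq : p ≫ F.left = q ≫ G.left)
    (α : p ≫ F.right ⟶ q ≫ G.right) (A A' : S ⟶ T)
    (hp : (A ≫ p) ≫ F.left = (A' ≫ p) ≫ F.left) (hq : (A ≫ q) ≫ G.left = (A' ≫ q) ≫ G.left) :
    A ◁ α ≫ G.transition hff hq (Category.assoc _ _ _).symm (Category.assoc _ _ _).symm =
      F.transition hff hp (Category.assoc _ _ _).symm (Category.assoc _ _ _).symm ≫ A' ◁ α := by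
  have hA : A ≫ p ≫ F.left = A' ≫ p ≫ F.left := by
    rw [← Category.assoc, hp, Category.assoc]
  have e := whisker_exchange ((hff _ hT).canonical hA) α
  rwa [F.canonical_whiskerRight_comp hff _ rfl, G.canonical_whiskerRight_comp hff _ hpq.symm] at e

theorem app_injective (hsub : J.Subcanonical) (hff : J.ContainedInFF) {T : K} {p : T ⟶ F.pt}
    {q : T ⟶ G.pt} (hT : J.cover (p ≫ F.left)) (h : p ≫ F.left = q ≫ G.left) {m n : T ⟶ y}
    (hm : m = p ≫ F.right) (hn : n = q ≫ G.right) {t t' : FractionMap F G}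
    (e : t.app p q h hm hn = t'.app p q h hm hn) : t = t' := by
  subst hm hn
  let d := (F.meet G).fst ≫ F.left
  -- `W.fst` is a cover of u ×_x v, so it suffices to compare on `W`. There the projections and the
  -- restrictions of p, q lie over one 1-arrow to x, hence transitions relate the values.
  let W := J.pb d (p ≫ F.left) hT
  have hW : W.fst ≫ (F.meet G).fst ≫ F.left = W.snd ≫ p ≫ F.left := J.condition d _ hT
  have hb : J.cover W.fst := J.pb_fst_cover _ _ _
  have hP : (W.fst ≫ (F.meet G).fst) ≫ F.left = (W.snd ≫ p) ≫ F.left := by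
    rw [Category.assoc, hW, Category.assoc]
  have hQ : (W.snd ≫ q) ≫ G.left = (W.fst ≫ (F.meet G).snd) ≫ G.left := by
    rw [Category.assoc, ← h, ← hW, J.condition F.left, Category.assoc]
  ext
  apply whiskerLeft_injective hsub hb
  rw [← app_meet, ← app_meet, whiskerLeft_app, whiskerLeft_app]
  rw [app_eq_transition_comp hff t hP hQ _ (by rw [Category.assoc, h, Category.assoc]) _ _
    (Category.assoc _ _ _).symm (Category.assoc _ _ _).symm,
    app_eq_transition_comp hff t' hP hQ _ (by rw [Category.assoc, h, Category.assoc]) _ _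
    (Category.assoc _ _ _).symm (Category.assoc _ _ _).symm,
    ← whiskerLeft_app t _ p q h rfl rfl, e, whiskerLeft_app]

/-- Conjugation of a 2-arrow `p ≫ F.right ⟶ q ≫ G.right` on `T`, restricted along `A`, by the
canonical 2-arrows from `P` to `A ≫ p` and from `A ≫ q` to `Q`. -/
def conj (hff : J.ContainedInFF) {S T : K} {p : T ⟶ F.pt} {q : T ⟶ G.pt}
    (α : p ≫ F.right ⟶ q ≫ G.right) (P : S ⟶ F.pt) (Q : S ⟶ G.pt) (A : S ⟶ T)
    (hP : P ≫ F.left = (A ≫ p) ≫ F.left) (hQ : (A ≫ q) ≫ G.left = Q ≫ G.left)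
    {m n : S ⟶ y} (hm : m = P ≫ F.right) (hn : n = Q ≫ G.right) : m ⟶ n :=
  F.transition hff hP hm (Category.assoc _ _ _).symm ≫
    A ◁ α ≫ G.transition hff hQ (Category.assoc _ _ _).symm hn

theorem recast_conj_congr (hff : J.ContainedInFF) {S T : K} {p : T ⟶ F.pt} {q : T ⟶ G.pt}
    (α : p ≫ F.right ⟶ q ≫ G.right) {P P' : S ⟶ F.pt} {Q Q' : S ⟶ G.pt} {A A' : S ⟶ T}
    (eP : P = P') (eQ : Q = Q') (eA : A = A')
    (hP : P ≫ F.left = (A ≫ p) ≫ F.left) (hQ : (A ≫ q) ≫ G.left = Q ≫ G.left)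
    (hP' : P' ≫ F.left = (A' ≫ p) ≫ F.left) (hQ' : (A' ≫ q) ≫ G.left = Q' ≫ G.left)
    {m n m' n' : S ⟶ y} (hm : m = P ≫ F.right) (hn : n = Q ≫ G.right)
    (hm' : m' = m) (hn' : n' = n) (hm'' : m' = P' ≫ F.right) (hn'' : n' = Q' ≫ G.right) :
    recast (conj hff α P Q A hP hQ hm hn) hm' hn' = conj hff α P' Q' A' hP' hQ' hm'' hn'' := by
  subst eP eQ eA hm' hn'; simp

theorem whiskerLeft_conj (hff : J.ContainedInFF) {R S T : K} {p : T ⟶ F.pt} {q : T ⟶ G.pt}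
    (α : p ≫ F.right ⟶ q ≫ G.right) (r : R ⟶ S) (P : S ⟶ F.pt) (Q : S ⟶ G.pt) (A : S ⟶ T)
    (hP : P ≫ F.left = (A ≫ p) ≫ F.left) (hQ : (A ≫ q) ≫ G.left = Q ≫ G.left)
    {m n : S ⟶ y} (hm : m = P ≫ F.right) (hn : n = Q ≫ G.right) :
    r ◁ conj hff α P Q A hP hQ hm hn =
      conj hff α (r ≫ P) (r ≫ Q) (r ≫ A) (by simp [hP]) (by simp [← hQ])
        (by rw [hm, Category.assoc]) (by rw [hn, Category.assoc]) := by
  rw [conj, whiskerLeft_comp, whiskerLeft_comp, Fraction.whiskerLeft_transition,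
    Fraction.whiskerLeft_transition, whiskerLeft_whiskerLeft_eq]
  exact F.transition_comp_recast_comp_transition hff (Category.assoc _ _ _).symm
    (Category.assoc _ _ _).symm _ _ _ _ _ _ _ _ _ _ _ _ _

/-- Changing `A` inserts a transition on each side of the restricted `α`, and these merge with the
outer ones. -/
theorem conj_eq_conj (hff : J.ContainedInFF) {S T : K} {p : T ⟶ F.pt} {q : T ⟶ G.pt}
    (hT : J.cover (p ≫ F.left)) (hpq : p ≫ F.left = q ≫ G.left)
    (α : p ≫ F.right ⟶ q ≫ G.right) (P : S ⟶ F.pt) (Q : S ⟶ G.pt) (A A' : S ⟶ T)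
    (hP : P ≫ F.left = (A ≫ p) ≫ F.left) (hQ : (A ≫ q) ≫ G.left = Q ≫ G.left)
    (hP' : P ≫ F.left = (A' ≫ p) ≫ F.left) (hQ' : (A' ≫ q) ≫ G.left = Q ≫ G.left)
    {m n : S ⟶ y} (hm : m = P ≫ F.right) (hn : n = Q ≫ G.right) :
    conj hff α P Q A hP hQ hm hn = conj hff α P Q A' hP' hQ' hm hn := by
  have := whiskerLeft_comp_transition hff hT hpq α A A' (by rw [← hP, hP']) (by rw [hQ, hQ'])
  rw [conj, conj, ← F.transition_comp hff hP (hP.symm.trans hP') hm (Category.assoc _ _ _).symm,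
    Category.assoc, ← reassoc_of% this, Fraction.transition_comp]

theorem exists_app_eq (hsub : J.Subcanonical) (hff : J.ContainedInFF) {T : K} {p : T ⟶ F.pt}
    {q : T ⟶ G.pt} (hT : J.cover (p ≫ F.left)) (h : p ≫ F.left = q ≫ G.left) {m n : T ⟶ y}
    (hm : m = p ≫ F.right) (hn : n = q ≫ G.right) (α : m ⟶ n) :
    ∃ t : FractionMap F G, t.app p q h hm hn = α := by
  subst hm hn
  let d := (F.meet G).fst ≫ F.left
  let W := J.pb d (p ≫ F.left) hT
  have hW : W.fst ≫ (F.meet G).fst ≫ F.left = W.snd ≫ p ≫ F.left := J.condition d _ hT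
  have hb : J.cover W.fst := J.pb_fst_cover _ _ _
  have hP : (W.fst ≫ (F.meet G).fst) ≫ F.left = (W.snd ≫ p) ≫ F.left := by
    rw [Category.assoc, hW, Category.assoc]
  have hQ : (W.snd ≫ q) ≫ G.left = (W.fst ≫ (F.meet G).snd) ≫ G.left := by
    rw [Category.assoc, ← h, ← hW, J.condition F.left, Category.assoc]
  obtain ⟨c, hc, -⟩ := hsub W.fst hb ((F.meet G).fst ≫ F.right) ((F.meet G).snd ≫ G.right)
    (conj hff α _ _ W.snd hP hQ (Category.assoc _ _ _).symm (Category.assoc _ _ _).symm) (by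
      rw [isDescentDatum_iff _ _ _ (by simp only [← Category.assoc, J.condition])
        (by simp only [← Category.assoc, J.condition]), whiskerLeft_conj, whiskerLeft_conj]
      -- On the kernel pair of `W.fst` both restrictions are conjugates of `α` with the same outer
      -- lifts, along the two restrictions of `W.snd`; hence they agree.
      have hb' := J.condition W.fst W.fst hb
      rw [recast_conj_congr hff α (by rw [← Category.assoc, ← hb', Category.assoc])
        (by rw [← Category.assoc, ← hb', Category.assoc]) rfl
        (hP' := by simp only [Category.assoc]; rw [reassoc_of% hb', hW])
        (hQ' := by
          simp only [Category.assoc]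
          rw [reassoc_of% hb', ← h, ← J.condition F.left, hW])
        (hm'' := by simp only [Category.assoc]) (hn'' := by simp only [Category.assoc])]
      apply conj_eq_conj hff hT h)
  refine ⟨⟨c⟩, ?_⟩
  -- To recover `α`, restrict along T → W with components (p, q) and the identity. There the outer
  -- lifts are p and q themselves, so both transitions are identities.
  let s : T ⟶ (F.meet G).pt := J.lift F.left G.left G.left_cover p q h
  have hs₁ : s ≫ (F.meet G).fst = p := J.lift_fst _ _ _ _ _ _
  have hs₂ : s ≫ (F.meet G).snd = q := J.lift_snd _ _ _ _ _ _
  have hs : s ≫ d = 𝟙 T ≫ p ≫ F.left := by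
    rw [← Category.assoc, hs₁, Category.id_comp]
  let S : T ⟶ W.pt := J.lift d _ hT s (𝟙 T) hs
  have hS₁ : S ≫ W.fst = s := J.lift_fst _ _ _ _ _ _
  have hS₂ : S ≫ W.snd = 𝟙 T := J.lift_snd _ _ _ _ _ _
  change recast (s ◁ c) _ _ = α
  rw [whiskerLeft_eq_of_eq hS₁.symm, comp_whiskerLeft_eq, hc, whiskerLeft_conj, recast_recast,
    recast_recast, recast_conj_congr hff α (by rw [← Category.assoc, hS₁, hs₁])
    (by rw [← Category.assoc, hS₁, hs₂]) hS₂ (hP' := by simp) (hQ' := by simp) (hm'' := rfl)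
    (hn'' := rfl), conj, Fraction.transition_of_eq _ _ (by simp),
    Fraction.transition_of_eq _ _ (by simp), id_whiskerLeft_eq]
  simp [recast]

end FractionMap

instance isIso_transition {x y : K} (F : J.Fraction x y) (hff : J.ContainedInFF) {T : K}
    {p p' : T ⟶ F.pt} (h : p ≫ F.left = p' ≫ F.left) {m m' : T ⟶ y} (hm : m = p ≫ F.right)
    (hm' : m' = p' ≫ F.right) : IsIso (F.transition hff h hm hm') :=
  ⟨F.transition hff h.symm hm' hm, by simp, by simp⟩

namespace FractionMap

variable {x y z : K} {F G H : J.Fraction x y}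

theorem app_existsUnique (hsub : J.Subcanonical) (hff : J.ContainedInFF) {T : K} {p : T ⟶ F.pt}
    {q : T ⟶ G.pt} (hT : J.cover (p ≫ F.left)) (h : p ≫ F.left = q ≫ G.left) {m n : T ⟶ y}
    (hm : m = p ≫ F.right) (hn : n = q ≫ G.right) (α : m ⟶ n) :
    ∃! t : FractionMap F G, t.app p q h hm hn = α := by
  obtain ⟨t, ht⟩ := exists_app_eq hsub hff hT h hm hn α
  exact ⟨t, ht, fun s hs => app_injective hsub hff hT h hm hn (hs.trans ht.symm)⟩

/-- The value at a restriction of `p` and `q` is the restriction of the value. -/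
theorem app_comp (t : FractionMap F G) {S T : K} (r : S ⟶ T) {p : T ⟶ F.pt}
    {q : T ⟶ G.pt} (h : p ≫ F.left = q ≫ G.left) {p' : S ⟶ F.pt} {q' : S ⟶ G.pt}
    (hp : r ≫ p = p') (hq : r ≫ q = q') (h' : p' ≫ F.left = q' ≫ G.left)
    {m n : T ⟶ y} {m' n' : S ⟶ y} (hm : m = p ≫ F.right) (hn : n = q ≫ G.right)
    (hm' : m' = p' ≫ F.right) (hn' : n' = q' ≫ G.right) (em : m' = r ≫ m) (en : n' = r ≫ n) :
    t.app p' q' h' hm' hn' = recast (r ◁ t.app p q h hm hn) em en := by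
  subst hp hq
  rw [whiskerLeft_app, recast_app]

/-! ### Vertical composition -/

theorem triple_left₁₂ (F G H : J.Fraction x y) :
    (pr₁₂ F G H ≫ (F.meet G).fst) ≫ F.left = (pr₁₂ F G H ≫ (F.meet G).snd) ≫ G.left := by
  rw [Category.assoc, J.condition F.left, Category.assoc]

theorem triple_left₁₃ (F G H : J.Fraction x y) :
    (pr₁₂ F G H ≫ (F.meet G).fst) ≫ F.left = (triple F G H).snd ≫ H.left := by
  rw [Category.assoc]
  exact J.condition _ _ _

theorem triple_left₂₃ (F G H : J.Fraction x y) :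
    (pr₁₂ F G H ≫ (F.meet G).snd) ≫ G.left = (triple F G H).snd ≫ H.left :=
  (triple_left₁₂ F G H).symm.trans (triple_left₁₃ F G H)

theorem triple_right₁ (F G H : J.Fraction x y) :
    pr₁₃ F G H ≫ (F.meet H).fst ≫ F.right = (pr₁₂ F G H ≫ (F.meet G).fst) ≫ F.right := by
  rw [← pr₁₃_fst, Category.assoc]

theorem triple_right₃ (F G H : J.Fraction x y) :
    pr₁₃ F G H ≫ (F.meet H).snd ≫ H.right = (triple F G H).snd ≫ H.right := by
  rw [← Category.assoc, pr₁₃, J.lift_snd]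

/-- The three projections of the triple pullback are the universal triple of lifts, so the pasting
condition is a statement about values there. -/
theorem isVerticalComp_iff (t₁ : FractionMap F G) (t₂ : FractionMap G H) (s : FractionMap F H) :
    IsVerticalComp t₁ t₂ s ↔
      s.app _ _ (triple_left₁₃ F G H) (triple_right₁ F G H) (triple_right₃ F G H) =
        t₁.app _ _ (triple_left₁₂ F G H) (triple_right₁ F G H) (Category.assoc _ _ _).symm ≫
          t₂.app _ _ (triple_left₂₃ F G H) (Category.assoc _ _ _).symm (triple_right₃ F G H) := by
  have e₁ : t₁.app _ _ (triple_left₁₂ F G H) (triple_right₁ F G H) (Category.assoc _ _ _).symm =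
      recast (pr₁₂ F G H ◁ t₁.cell) ((triple_right₁ F G H).trans (Category.assoc _ _ _)) rfl := by
    rw [← app_meet, whiskerLeft_app, recast_app]
  have e₂ : s.app _ _ (triple_left₁₃ F G H) (triple_right₁ F G H) (triple_right₃ F G H) =
      pr₁₃ F G H ◁ s.cell := recast_rfl _ _ _
  rw [e₁, e₂, IsVerticalComp, precomp]
  simp [app, recast, pr₂₃]

theorem existsUnique_isVerticalComp (hsub : J.Subcanonical) (hff : J.ContainedInFF)
    (t₁ : FractionMap F G) (t₂ : FractionMap G H) : ∃! s, IsVerticalComp t₁ t₂ s := by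
  simp only [isVerticalComp_iff]
  refine app_existsUnique hsub hff ?_ _ _ _ _
  -- Only the composite from the triple pullback to x has to be a cover; nothing is needed about
  -- `pr₁₃` itself.
  rw [Category.assoc]
  exact J.comp_cover _ _ (J.pb_fst_cover _ _ _)
    (J.comp_cover _ _ (J.pb_fst_cover _ _ _) F.left_cover)

/-- The vertical composite of two maps of fractions. -/
def vcomp (hsub : J.Subcanonical) (hff : J.ContainedInFF)
    (t₁ : FractionMap F G) (t₂ : FractionMap G H) : FractionMap F H :=
  (existsUnique_isVerticalComp hsub hff t₁ t₂).choose

theorem isVerticalComp_iff_eq_vcomp (hsub : J.Subcanonical) (hff : J.ContainedInFF)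
    (t₁ : FractionMap F G) (t₂ : FractionMap G H) (s : FractionMap F H) :
    IsVerticalComp t₁ t₂ s ↔ s = vcomp hsub hff t₁ t₂ := by
  have := (existsUnique_isVerticalComp hsub hff t₁ t₂).choose_spec
  exact ⟨this.2 s, fun h => h ▸ this.1⟩

theorem vcomp_app (hsub : J.Subcanonical) (hff : J.ContainedInFF)
    (t₁ : FractionMap F G) (t₂ : FractionMap G H) {T : K} {p : T ⟶ F.pt} (q : T ⟶ G.pt)
    {r : T ⟶ H.pt} (hpr : p ≫ F.left = r ≫ H.left) (hpq : p ≫ F.left = q ≫ G.left)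
    (hqr : q ≫ G.left = r ≫ H.left) {m k n : T ⟶ y} (hm : m = p ≫ F.right)
    (hk : k = q ≫ G.right) (hn : n = r ≫ H.right) :
    (vcomp hsub hff t₁ t₂).app p r hpr hm hn =
      t₁.app p q hpq hm hk ≫ t₂.app q r hqr hk hn := by
  have := (isVerticalComp_iff t₁ t₂ _).1 ((isVerticalComp_iff_eq_vcomp hsub hff t₁ t₂ _).2 rfl)
  subst hm hk hn
  let B : T ⟶ (F.meet G).pt := J.lift F.left G.left G.left_cover p q hpq
  have hB₁ : B ≫ (F.meet G).fst = p := J.lift_fst _ _ _ _ _ _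
  have hB₂ : B ≫ (F.meet G).snd = q := J.lift_snd _ _ _ _ _ _
  -- `A` is (p, q, r); the defining identity of the composite is restricted along it.
  let A : T ⟶ (triple F G H).pt := J.lift ((F.meet G).fst ≫ F.left) H.left H.left_cover B r
    (by rw [← Category.assoc, hB₁, hpr])
  have hA₁ : A ≫ pr₁₂ F G H = B := J.lift_fst _ _ _ _ _ _
  have hA₂ : A ≫ (triple F G H).snd = r := J.lift_snd _ _ _ _ _ _
  have e₁ : A ≫ pr₁₂ F G H ≫ (F.meet G).fst = p := by rw [← Category.assoc, hA₁, hB₁]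
  have e₂ : A ≫ pr₁₂ F G H ≫ (F.meet G).snd = q := by rw [← Category.assoc, hA₁, hB₂]
  have e₃ : A ≫ pr₁₃ F G H = J.lift F.left H.left H.left_cover p r hpr :=
    pb_hom_ext (by rw [Category.assoc, pr₁₃_fst, e₁, J.lift_fst])
      (by rw [Category.assoc, pr₁₃_snd, pr₂₃, J.lift_snd, hA₂, J.lift_snd])
  have f₁ : p ≫ F.right = A ≫ pr₁₃ F G H ≫ (F.meet H).fst ≫ F.right := by
    rw [← Category.assoc, e₃, ← Category.assoc, J.lift_fst]
  have f₂ : q ≫ G.right = A ≫ pr₁₂ F G H ≫ (F.meet G).snd ≫ G.right := by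
    rw [← Category.assoc, hA₁, ← Category.assoc, hB₂]
  have f₃ : r ≫ H.right = A ≫ pr₁₃ F G H ≫ (F.meet H).snd ≫ H.right := by
    rw [← Category.assoc, e₃, ← Category.assoc, J.lift_snd]
  rw [app_comp _ A (triple_left₁₃ F G H) e₁ hA₂ _ (triple_right₁ F G H) (triple_right₃ F G H) _ _
    f₁ f₃, this, whiskerLeft_comp,
    app_comp t₁ A (triple_left₁₂ F G H) e₁ e₂ _ (triple_right₁ F G H)
    (Category.assoc _ _ _).symm _ _ f₁ f₂, app_comp t₂ A (triple_left₂₃ F G H) e₂ hA₂ _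
    (Category.assoc _ _ _).symm (triple_right₃ F G H) _ _ f₂ f₃,
    recast_comp_recast]

end FractionMap

/-! ### Maps associated with renaming maps -/

namespace RenamingMap

variable {x y : K} {F G : J.Fraction x y} (hff : J.ContainedInFF)

theorem toMap_cell (r : RenamingMap F G) (h) :
    (r.toMap hff).cell =
      (F.meet G).fst ◁ r.cell ≫
        G.transition hff (p := (F.meet G).fst ≫ r.arrow) (p' := (F.meet G).snd) h
          (Category.assoc _ _ _).symm rfl := by
  simp [toMap, Fraction.transition, recast]

/-- At q = r p the canonical 2-arrow in ι(r) joins equal 1-arrows, so only the 2-arrow of the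
renaming map survives. -/
theorem toMap_app (r : RenamingMap F G) {T : K} {p : T ⟶ F.pt} {q : T ⟶ G.pt}
    (hq : p ≫ r.arrow = q) (h : p ≫ F.left = q ≫ G.left) {m n : T ⟶ y} (hm : m = p ≫ F.right)
    (hn : n = q ≫ G.right) (hn' : n = p ≫ r.arrow ≫ G.right) :
    (r.toMap hff).app p q h hm hn = recast (p ◁ r.cell) hm hn' := by
  subst hq hm
  have e₁ : J.lift F.left G.left G.left_cover _ _ h ≫ (F.meet G).fst = p := J.lift_fst _ _ _ _ _ _
  have e₂ : J.lift F.left G.left G.left_cover _ _ h ≫ (F.meet G).snd = p ≫ r.arrow :=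
    J.lift_snd _ _ _ _ _ _
  rw [FractionMap.app, toMap_cell hff r (by rw [Category.assoc, r.arrow_left, J.condition]),
    whiskerLeft_comp, Fraction.whiskerLeft_transition,
    Fraction.transition_of_eq _ _ (by rw [← Category.assoc, e₁, e₂]), whiskerLeft_whiskerLeft_eq,
    whiskerLeft_eq_of_eq e₁]
  simp [recast]

theorem toMap_app_of_eqToHom (r : RenamingMap F G) (e : F.right = r.arrow ≫ G.right)
    (hr : r.cell = eqToHom e) {T : K} {p : T ⟶ F.pt} {q : T ⟶ G.pt}
    (hq : p ≫ r.arrow = q) (h : p ≫ F.left = q ≫ G.left) {m : T ⟶ y} (hm : m = p ≫ F.right)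
    (hn : m = q ≫ G.right) :
    (r.toMap hff).app p q h hm hn = 𝟙 m := by
  rw [r.toMap_app hff hq h hm hn (by rw [hm, e]), hr]
  simp

end RenamingMap

/-! ### Generalized elements of a composite of fractions -/

namespace Fraction

variable {x y z : K}

/-- The 1-arrow into the middle object of a composite of fractions given by its universal
property. -/
def pair (F : J.Fraction x y) (G : J.Fraction y z) {T : K} (p : T ⟶ F.pt) (s : T ⟶ G.pt)
    (h : p ≫ F.right = s ≫ G.left) : T ⟶ (F.comp G).pt :=
  J.lift F.right G.left G.left_cover p s h

variable (F : J.Fraction x y) (G : J.Fraction y z) {T : K} (p : T ⟶ F.pt) (s : T ⟶ G.pt)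
    (h : p ≫ F.right = s ≫ G.left)

theorem pair_fst : F.pair G p s h ≫ (J.pb F.right G.left G.left_cover).fst = p :=
  J.lift_fst _ _ _ _ _ _

theorem pair_snd : F.pair G p s h ≫ (J.pb F.right G.left G.left_cover).snd = s :=
  J.lift_snd _ _ _ _ _ _

theorem pair_left : F.pair G p s h ≫ (F.comp G).left = p ≫ F.left := by
  change _ ≫ _ ≫ _ = _
  rw [← Category.assoc, pair_fst]

theorem pair_right : F.pair G p s h ≫ (F.comp G).right = s ≫ G.right := by
  change _ ≫ _ ≫ _ = _
  rw [← Category.assoc, pair_snd]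

end Fraction

/-! ### Right whiskering -/

section

variable {x y z : K} {F G : J.Fraction x y} (hff : J.ContainedInFF)

theorem rightWhiskerCell_whiskerRight (t : FractionMap F G) (L : J.Fraction y z) (h hm hn) :
    rightWhiskerCell hff t L ▷ L.left =
      t.app (((F.comp L).meet (G.comp L)).fst ≫ (J.pb F.right L.left L.left_cover).fst)
        (((F.comp L).meet (G.comp L)).snd ≫ (J.pb G.right L.left L.left_cover).fst) h hm hn :=
  (hff _ L.left_cover).lift_whiskerRight _

/-- The lift `σ` is an argument: any 2-arrow over the value of `t` will do, so callers can supply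
composites and identities. -/
theorem rightWhisker_app (t : FractionMap F G) (L : J.Fraction y z) {T : K} {p : T ⟶ F.pt}
    {q : T ⟶ G.pt} {s s' : T ⟶ L.pt} (hp : p ≫ F.right = s ≫ L.left)
    (hq : q ≫ G.right = s' ≫ L.left) (h : p ≫ F.left = q ≫ G.left) (σ : s ⟶ s')
    (hσ : σ ▷ L.left = t.app p q h hp.symm hq.symm) (h' hm hn) :
    (rightWhisker hff t L).app (F.pair L p s hp) (G.pair L q s' hq) h'
      (m := s ≫ L.right) (n := s' ≫ L.right) hm hn = σ ▷ L.right := by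
  let A := J.lift (F.comp L).left (G.comp L).left (G.comp L).left_cover _ _ h'
  have e₁ : A ≫ ((F.comp L).meet (G.comp L)).fst = F.pair L p s hp := J.lift_fst _ _ _ _ _ _
  have e₂ : A ≫ ((F.comp L).meet (G.comp L)).snd = G.pair L q s' hq := J.lift_snd _ _ _ _ _ _
  have f₁ : A ≫ ((F.comp L).meet (G.comp L)).fst ≫ (J.pb F.right L.left L.left_cover).snd = s := by
    rw [← Category.assoc, e₁, Fraction.pair_snd]
  have f₂ : A ≫ ((F.comp L).meet (G.comp L)).snd ≫ (J.pb G.right L.left L.left_cover).snd = s' := by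
    rw [← Category.assoc, e₂, Fraction.pair_snd]
  have g₁ : A ≫ ((F.comp L).meet (G.comp L)).fst ≫ (J.pb F.right L.left L.left_cover).fst = p := by
    rw [← Category.assoc, e₁, Fraction.pair_fst]
  have g₂ : A ≫ ((F.comp L).meet (G.comp L)).snd ≫ (J.pb G.right L.left L.left_cover).fst = q := by
    rw [← Category.assoc, e₂, Fraction.pair_fst]
  -- Both sides have the same image under the ff left leg of `L`, namely the value of `t` at (p, q).
  have key : A ◁ rightWhiskerCell hff t L = recast σ f₁ f₂ := by
    apply (hff _ L.left_cover).ext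
    rw [whiskerLeft_whiskerRight_eq, rightWhiskerCell_whiskerRight hff t L
      (by simpa only [Category.assoc] using
        J.condition (F.comp L).left (G.comp L).left (G.comp L).left_cover)
      (by simp only [Category.assoc, J.condition]) (by simp only [Category.assoc, J.condition]),
      recast_whiskerRight, hσ, FractionMap.recast_app, FractionMap.app_comp t A _ g₁ g₂]
  change recast (A ◁ (eqToHom _ ≫ rightWhiskerCell hff t L ▷ L.right ≫ eqToHom _)) _ _ = _
  rw [eqToHom_comp_eq_recast, comp_eqToHom_eq_recast, recast_recast, whiskerLeft_recast,
    whiskerLeft_whiskerRight_eq_symm, key]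
  simp only [recast_whiskerRight, recast_recast, recast_rfl]

theorem rightWhisker_app_eq_recast (t : FractionMap F G) (L : J.Fraction y z) {T : K}
    {p : T ⟶ F.pt} {q : T ⟶ G.pt} {s s' : T ⟶ L.pt} (hp : p ≫ F.right = s ≫ L.left)
    (hq : q ≫ G.right = s' ≫ L.left) (h : p ≫ F.left = q ≫ G.left) (σ : s ⟶ s')
    (hσ : σ ▷ L.left = t.app p q h hp.symm hq.symm) (h') {m n : T ⟶ z} (hm hn)
    (hm' : m = s ≫ L.right) (hn' : n = s' ≫ L.right) :
    (rightWhisker hff t L).app (F.pair L p s hp) (G.pair L q s' hq) h' (m := m) (n := n) hm hn =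
      recast (σ ▷ L.right) hm' hn' := by
  subst hm' hn'
  rw [recast_rfl, rightWhisker_app hff t L hp hq h σ hσ]

end

/-! ### Left whiskering -/

section

variable {x y z : K} (hff : J.ContainedInFF)

theorem push_meet_left {a : K} (j : a ⟶ x) (hj : J.cover j) (G H : J.Fraction a z) :
    (G.meet H).fst ≫ (G.push j hj).left = (G.meet H).snd ≫ (H.push j hj).left := by
  change _ ≫ _ ≫ _ = _ ≫ _ ≫ _
  rw [← Category.assoc, J.condition, Category.assoc]

/-- On v₁₂ ×_x V₁₂ the prescribed pasting is `t` between two transitions, and the restriction of `s`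
along the second projection is its value at the projections of v₁₂ between the same transitions.
These are invertible, and the remaining restriction is along the first projection, a cover. -/
theorem isLeftWhiskerII_iff (hsub : J.Subcanonical) {a : K} (j : a ⟶ x) (hj : J.cover j)
    {G H : J.Fraction a z} (t : FractionMap G H)
    (s : FractionMap (G.push j hj) (H.push j hj)) :
    IsLeftWhiskerII j hj hff t s ↔
      s.app (G.meet H).fst (G.meet H).snd (push_meet_left j hj G H) rfl rfl = t.cell := by
  have e₁ : (caseIIPb j hj G H).snd ◁ s.cell =
      s.app ((caseIIPb j hj G H).snd ≫ (bigMeet j hj G H).fst)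
        ((caseIIPb j hj G H).snd ≫ (bigMeet j hj G H).snd)
        (by rw [Category.assoc, J.condition, Category.assoc]) (Category.assoc _ _ _).symm
        (Category.assoc _ _ _).symm := by
    rw [← FractionMap.app_meet, FractionMap.whiskerLeft_app]
  have hd := hff _ (bigMeetLeft_cover j hj G H)
  have c := caseIIPb_condition j hj G H
  have e₂ := (G.push j hj).canonical_whiskerRight_comp hff hd (D := (bigMeet j hj G H).fst) rfl
    c.symm (by simpa only [Category.assoc] using c.symm)
  have cond : (bigMeet j hj G H).snd ≫ (H.push j hj).left = bigMeetLeft j hj G H :=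
    (J.condition (G.push j hj).left _ (H.push j hj).left_cover).symm
  have e₃ := (H.push j hj).canonical_whiskerRight_comp hff hd cond c
    (by rw [Category.assoc, cond, c, Category.assoc, cond])
  have f₁ : (caseIIPb j hj G H).fst ≫ (G.meet H).fst =
      ((caseIIPb j hj G H).fst ≫ meetToBigMeet j hj G H) ≫ (bigMeet j hj G H).fst := by
    rw [Category.assoc, meetToBigMeet_fst]
  have f₂ : (caseIIPb j hj G H).fst ≫ (G.meet H).snd =
      ((caseIIPb j hj G H).fst ≫ meetToBigMeet j hj G H) ≫ (bigMeet j hj G H).snd := by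
    rw [Category.assoc, meetToBigMeet_snd]
  have g₁ : ((caseIIPb j hj G H).fst ≫ meetToBigMeet j hj G H) ≫ (bigMeet j hj G H).fst ≫ G.right =
      (caseIIPb j hj G H).fst ≫ (G.meet H).fst ≫ G.right := by
    rw [← Category.assoc, ← f₁, Category.assoc]
  have g₂ : ((caseIIPb j hj G H).fst ≫ meetToBigMeet j hj G H) ≫ (bigMeet j hj G H).snd ≫ H.right =
      (caseIIPb j hj G H).fst ≫ (G.meet H).snd ≫ H.right := by
    rw [← Category.assoc, ← f₂, Category.assoc]
  rw [IsLeftWhiskerII, e₁, e₂, e₃, eqToHom_comp_comp_eqToHom_comp, s.app_eq_transition_comp hff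
    (p' := ((caseIIPb j hj G H).fst ≫ meetToBigMeet j hj G H) ≫ (bigMeet j hj G H).fst)
    (q' := ((caseIIPb j hj G H).fst ≫ meetToBigMeet j hj G H) ≫ (bigMeet j hj G H).snd)
    (by simpa only [Category.assoc] using c.symm)
    (by rw [Category.assoc, cond, c, Category.assoc, cond]) _
    (by rw [Category.assoc, J.condition]; simp only [Category.assoc]) _ _
    (Category.assoc _ _ _).symm (Category.assoc _ _ _).symm, cancel_epi, cancel_mono,
    s.app_comp (caseIIPb j hj G H).fst (push_meet_left j hj G H) f₁ f₂ _ rfl rfl _ _ g₁ g₂,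
    recast_inj]
  exact ⟨whiskerLeft_injective hsub (J.pb_fst_cover _ _ _), fun h => by rw [h]⟩

theorem leftWhiskerI_cell {a : K} (f : a ⟶ y) {G H : J.Fraction y z} (t : FractionMap G H)
    (h hm hn) :
    (leftWhiskerI f t).cell = 
      t.app (((G.pullback f).meet (H.pullback f)).fst ≫ (J.pb f G.left G.left_cover).snd)
        (((G.pullback f).meet (H.pullback f)).snd ≫ (J.pb f H.left H.left_cover).snd) h hm hn :=
  rfl

theorem existsUnique_isLeftWhisker (hsub : J.Subcanonical) (F : J.Fraction x y)
    {G H : J.Fraction y z} (t : FractionMap G H) : ∃! s, IsLeftWhisker hff F t s := by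
  simp only [IsLeftWhisker, isLeftWhiskerII_iff hff hsub]
  refine FractionMap.app_existsUnique hsub hff ?_ _ _ _ _
  -- The 1-arrow from (u ×_y v₁) ×_u (u ×_y v₂) to x is a cover, so prescribing a value on it
  -- determines the map.
  exact J.comp_cover _ _ (J.pb_fst_cover _ _ _)
    (J.comp_cover _ _ (J.pb_fst_cover _ _ _) F.left_cover)

/-- The left whiskering of a map of fractions. -/
def lwhisker (hsub : J.Subcanonical) (F : J.Fraction x y)
    {G H : J.Fraction y z} (t : FractionMap G H) : FractionMap (F.comp G) (F.comp H) :=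
  (existsUnique_isLeftWhisker hff hsub F t).choose

theorem isLeftWhisker_iff_eq_lwhisker (hsub : J.Subcanonical) (F : J.Fraction x y)
    {G H : J.Fraction y z} (t : FractionMap G H) (s : FractionMap (F.comp G) (F.comp H)) :
    IsLeftWhisker hff F t s ↔ s = lwhisker hff hsub F t := by
  have := (existsUnique_isLeftWhisker hff hsub F t).choose_spec
  exact ⟨this.2 s, fun h => h ▸ this.1⟩

/-- A shared first component `p` makes the two pairs a 1-arrow into the pullback over u, where the
whiskered map is given by `t`. -/
theorem lwhisker_app (hsub : J.Subcanonical) (F : J.Fraction x y)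
    {G H : J.Fraction y z} (t : FractionMap G H) {T : K} {p : T ⟶ F.pt} {s : T ⟶ G.pt}
    {s' : T ⟶ H.pt} (hs : p ≫ F.right = s ≫ G.left) (hs' : p ≫ F.right = s' ≫ H.left)
    (h) {m n : T ⟶ z} (hm hn) (hm' : m = s ≫ G.right) (hn' : n = s' ≫ H.right) :
    (lwhisker hff hsub F t).app (F.pair G p s hs) (F.pair H p s' hs') h (m := m) (n := n) hm hn =
      t.app s s' (hs.symm.trans hs') hm' hn' := by
  have := (isLeftWhisker_iff_eq_lwhisker hff hsub F t _).2 rfl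
  have hA : F.pair G p s hs ≫ (G.pullback F.right).left =
      F.pair H p s' hs' ≫ (H.pullback F.right).left :=
    (F.pair_fst G p s hs).trans (F.pair_fst H p s' hs').symm
  let A := J.lift (G.pullback F.right).left _ (H.pullback F.right).left_cover _ _ hA
  have e₁ : A ≫ ((G.pullback F.right).meet (H.pullback F.right)).fst = F.pair G p s hs :=
    J.lift_fst _ _ _ _ _ _
  have e₂ : A ≫ ((G.pullback F.right).meet (H.pullback F.right)).snd = F.pair H p s' hs' :=
    J.lift_snd _ _ _ _ _ _
  have f₁ : A ≫ ((G.pullback F.right).meet (H.pullback F.right)).fst ≫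
      (J.pb F.right G.left G.left_cover).snd = s := by
    rw [← Category.assoc, e₁, Fraction.pair_snd]
  have f₂ : A ≫ ((G.pullback F.right).meet (H.pullback F.right)).snd ≫
      (J.pb F.right H.left H.left_cover).snd = s' := by
    rw [← Category.assoc, e₂, Fraction.pair_snd]
  have g₁ : m = A ≫ ((G.pullback F.right).meet (H.pullback F.right)).fst ≫
      (G.pullback F.right).right := by
    rw [← Category.assoc, e₁, hm]
  have g₂ : n = A ≫ ((G.pullback F.right).meet (H.pullback F.right)).snd ≫
      (H.pullback F.right).right := by
    rw [← Category.assoc, e₂, hn]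
  rw [IsLeftWhisker, isLeftWhiskerII_iff hff hsub, leftWhiskerI_cell F.right t
    (by
      have := J.condition (G.pullback F.right).left _ (H.pullback F.right).left_cover
      simp only [Category.assoc, ← J.condition F.right]
      rw [reassoc_of% this])
    (Category.assoc _ _ _).symm (Category.assoc _ _ _).symm] at this
  refine (FractionMap.app_comp (F := F.comp G) (G := F.comp H) _ A
    (push_meet_left F.left F.left_cover (G.pullback F.right) (H.pullback F.right)) e₁ e₂ _ rfl rfl _ _ g₁ g₂).trans ?_
  rw [this, FractionMap.app_comp t A _ f₁ f₂]

end


/-! ### Common refinements -/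

theorem exists_lift {T y z : K} (c : T ⟶ y) (G : J.Fraction y z) :
    ∃ (S : K) (e : S ⟶ T) (s : S ⟶ G.pt), J.cover e ∧ e ≫ c = s ≫ G.left :=
  ⟨_, _, _, J.pb_fst_cover c G.left G.left_cover, J.condition _ _ _⟩

/-- Successive pullback of the covers. Four lifts suffice for every law below; when fewer are
needed, the spare slots hold repeated fractions and are discarded. -/
theorem exists_lifts {T y₁ y₂ y₃ y₄ z₁ z₂ z₃ z₄ : K} (c₁ : T ⟶ y₁) (c₂ : T ⟶ y₂) (c₃ : T ⟶ y₃)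
    (c₄ : T ⟶ y₄) (G₁ : J.Fraction y₁ z₁) (G₂ : J.Fraction y₂ z₂) (G₃ : J.Fraction y₃ z₃)
    (G₄ : J.Fraction y₄ z₄) :
    ∃ (S : K) (e : S ⟶ T) (s₁ : S ⟶ G₁.pt) (s₂ : S ⟶ G₂.pt) (s₃ : S ⟶ G₃.pt) (s₄ : S ⟶ G₄.pt),
      J.cover e ∧ e ≫ c₁ = s₁ ≫ G₁.left ∧ e ≫ c₂ = s₂ ≫ G₂.left ∧ e ≫ c₃ = s₃ ≫ G₃.left ∧
        e ≫ c₄ = s₄ ≫ G₄.left := by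
  obtain ⟨S₁, e₁, s₁, he₁, hs₁⟩ := exists_lift c₁ G₁
  obtain ⟨S₂, e₂, s₂, he₂, hs₂⟩ := exists_lift (e₁ ≫ c₂) G₂
  obtain ⟨S₃, e₃, s₃, he₃, hs₃⟩ := exists_lift (e₂ ≫ e₁ ≫ c₃) G₃
  obtain ⟨S₄, e₄, s₄, he₄, hs₄⟩ := exists_lift (e₃ ≫ e₂ ≫ e₁ ≫ c₄) G₄
  refine ⟨S₄, e₄ ≫ e₃ ≫ e₂ ≫ e₁, e₄ ≫ e₃ ≫ e₂ ≫ s₁, e₄ ≫ e₃ ≫ s₂, e₄ ≫ s₃, s₄,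
    J.comp_cover _ _ he₄ (J.comp_cover _ _ he₃ (J.comp_cover _ _ he₂ he₁)), ?_, ?_, ?_, ?_⟩
  · simp only [Category.assoc, hs₁]
  · simp only [Category.assoc, hs₂]
  · simp only [Category.assoc, hs₃]
  · simp only [Category.assoc, hs₄]

/-! ### Category laws for vertical composition -/

namespace FractionMap

variable {x y z : K} (hsub : J.Subcanonical) (hff : J.ContainedInFF)

/-- The identity map of a fraction. -/
abbrev idMap (F : J.Fraction x y) : FractionMap F F := (RenamingMap.id F).toMap hff

theorem idMap_app (F : J.Fraction x y) {T : K} (p : T ⟶ F.pt) (h) {m : T ⟶ y} (hm hm') :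
    (idMap hff F).app p p h (m := m) hm hm' = 𝟙 m :=
  (RenamingMap.id F).toMap_app_of_eqToHom hff (Category.id_comp _).symm rfl (Category.comp_id _)
    h hm hm'

variable {F G H I : J.Fraction x y}

theorem id_vcomp (t : FractionMap F G) : vcomp hsub hff (idMap hff F) t = t := by
  obtain ⟨T, e, p, q, -, -, he, hp, hq, -, -⟩ := exists_lifts (𝟙 x) (𝟙 x) (𝟙 x) (𝟙 x) F G F G
  -- Lifting the identity of x makes the cover `e` equal to p followed by the left leg, as
  -- `app_injective` requires.
  rw [Category.comp_id] at hp hq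
  refine app_injective hsub hff (hp ▸ he) (hp.symm.trans hq) rfl rfl ?_
  rw [vcomp_app hsub hff _ _ p _ rfl (hp.symm.trans hq) _ rfl _, idMap_app, Category.id_comp]

theorem vcomp_id (t : FractionMap F G) : vcomp hsub hff t (idMap hff G) = t := by
  obtain ⟨T, e, p, q, -, -, he, hp, hq, -, -⟩ := exists_lifts (𝟙 x) (𝟙 x) (𝟙 x) (𝟙 x) F G F G
  rw [Category.comp_id] at hp hq
  refine app_injective hsub hff (hp ▸ he) (hp.symm.trans hq) rfl rfl ?_
  rw [vcomp_app hsub hff _ _ q _ (hp.symm.trans hq) rfl _ rfl _, idMap_app, Category.comp_id]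

theorem vcomp_assoc (t₁ : FractionMap F G) (t₂ : FractionMap G H) (t₃ : FractionMap H I) :
    vcomp hsub hff (vcomp hsub hff t₁ t₂) t₃ = vcomp hsub hff t₁ (vcomp hsub hff t₂ t₃) := by
  obtain ⟨T, e, p, q, r, s, he, hp, hq, hr, hs⟩ :=
    exists_lifts (𝟙 x) (𝟙 x) (𝟙 x) (𝟙 x) F G H I
  rw [Category.comp_id] at hp hq hr hs
  refine app_injective hsub hff (hp ▸ he) (hp.symm.trans hs) rfl rfl ?_
  rw [vcomp_app hsub hff _ t₃ r _ (hp.symm.trans hr) (hr.symm.trans hs) _ rfl _,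
    vcomp_app hsub hff t₁ t₂ q _ (hp.symm.trans hq) (hq.symm.trans hr) _ rfl _,
    vcomp_app hsub hff t₁ _ q _ (hp.symm.trans hq) (hq.symm.trans hs) _ rfl _,
    vcomp_app hsub hff t₂ t₃ r _ (hq.symm.trans hr) (hr.symm.trans hs) _ rfl _, Category.assoc]

end FractionMap

open FractionMap

/-- The category of fractions between two objects. -/
abbrev fractionCategory (hsub : J.Subcanonical) (hff : J.ContainedInFF) (x y : K) :
    Category.{w} (J.Fraction x y) where
  Hom F G := FractionMap F G
  id F := idMap hff F
  comp t₁ t₂ := vcomp hsub hff t₁ t₂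
  id_comp := id_vcomp hsub hff
  comp_id := vcomp_id hsub hff
  assoc := vcomp_assoc hsub hff

/-! ### Inverses of renaming maps, functoriality of whiskering, interchange -/

section Structure

variable {x y z : K} (hsub : J.Subcanonical) (hff : J.ContainedInFF)

/-- A map of fractions induced by a renaming map with identity 2-arrow is invertible. -/
theorem RenamingMap.exists_inverse {F G : J.Fraction x y} (r : RenamingMap F G)
    (e : F.right = r.arrow ≫ G.right) (hr : r.cell = eqToHom e) :
    ∃ s : FractionMap G F, vcomp hsub hff (r.toMap hff) s = idMap hff F ∧
      vcomp hsub hff s (r.toMap hff) = idMap hff G := by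
  have hG : J.cover (r.arrow ≫ G.left) := r.arrow_left.symm ▸ F.left_cover
  have hF : J.cover (𝟙 F.pt ≫ F.left) := (Category.id_comp F.left).symm ▸ F.left_cover
  have h : 𝟙 F.pt ≫ F.left = r.arrow ≫ G.left := by rw [Category.id_comp, r.arrow_left]
  have hm : F.right = 𝟙 F.pt ≫ F.right := (Category.id_comp _).symm
  -- The inverse is defined by the identity value at (r, 𝟙), which lies over the left leg of `F`, a
  -- cover. Both composites then have identity values.
  obtain ⟨s, hs⟩ := exists_app_eq hsub hff hG h.symm e hm (𝟙 F.right)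
  have hr' := r.toMap_app_of_eqToHom hff e hr (Category.id_comp _) h hm e
  refine ⟨s, app_injective hsub hff hF rfl hm hm ?_, app_injective hsub hff hG rfl e e ?_⟩
  · rw [vcomp_app hsub hff _ _ _ _ h h.symm hm e hm, hs, hr', idMap_app, Category.comp_id]
  · rw [vcomp_app hsub hff _ _ _ _ h.symm h e hm e, hs, hr', idMap_app, Category.comp_id]

theorem lwhisker_id (F : J.Fraction x y) (G : J.Fraction y z) :
    lwhisker hff hsub F (idMap hff G) = idMap hff (F.comp G) := by
  obtain ⟨T, p, s, hp, hs⟩ := exists_lift F.right G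
  refine app_injective hsub hff (p := F.pair G p s hs) ?_ rfl (F.pair_right G p s hs).symm
    (F.pair_right G p s hs).symm ?_
  · rw [F.pair_left]
    exact J.comp_cover _ _ hp F.left_cover
  · rw [lwhisker_app hff hsub F _ hs hs _ _ _ rfl rfl, idMap_app, idMap_app]

theorem lwhisker_vcomp (F : J.Fraction x y) {G₁ G₂ G₃ : J.Fraction y z} (t₁ : FractionMap G₁ G₂)
    (t₂ : FractionMap G₂ G₃) :
    lwhisker hff hsub F (vcomp hsub hff t₁ t₂) =
      vcomp hsub hff (lwhisker hff hsub F t₁) (lwhisker hff hsub F t₂) := by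
  obtain ⟨T, p, s₁, s₂, s₃, -, hp, h₁, h₂, h₃, -⟩ :=
    exists_lifts F.right F.right F.right F.right G₁ G₂ G₃ G₃
  have l {G G' : J.Fraction y z} (s s' hs hs') :
      F.pair G p s hs ≫ (F.comp G).left = F.pair G' p s' hs' ≫ (F.comp G').left := by
    rw [F.pair_left, F.pair_left]
  refine app_injective hsub hff (p := F.pair G₁ p s₁ h₁) (q := F.pair G₃ p s₃ h₃) ?_ (l _ _ _ _)
    (F.pair_right G₁ p s₁ h₁).symm (F.pair_right G₃ p s₃ h₃).symm ?_
  · rw [F.pair_left]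
    exact J.comp_cover _ _ hp F.left_cover
  · rw [lwhisker_app hff hsub F _ h₁ h₃ _ _ _ rfl rfl,
      vcomp_app hsub hff _ _ s₂ _ (h₁.symm.trans h₂) (h₂.symm.trans h₃) _ rfl _,
      vcomp_app hsub hff _ _ (F.pair G₂ p s₂ h₂) _ (l _ _ _ _) (l _ _ _ _) _
        (F.pair_right G₂ p s₂ h₂).symm _,
      lwhisker_app hff hsub F _ h₁ h₂ _ _ _ rfl rfl, lwhisker_app hff hsub F _ h₂ h₃ _ _ _ rfl rfl]

theorem rightWhisker_id (hsub : J.Subcanonical) (F : J.Fraction x y) (L : J.Fraction y z) :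
    rightWhisker hff (idMap hff F) L = idMap hff (F.comp L) := by
  obtain ⟨T, p, s, hp, hs⟩ := exists_lift F.right L
  refine app_injective hsub hff (p := F.pair L p s hs) ?_ rfl (F.pair_right L p s hs).symm
    (F.pair_right L p s hs).symm ?_
  · rw [F.pair_left]
    exact J.comp_cover _ _ hp F.left_cover
  · rw [rightWhisker_app hff _ L hs hs rfl (𝟙 s) (by rw [idMap_app, id_whiskerRight]), idMap_app,
      id_whiskerRight]

theorem rightWhisker_vcomp {F₁ F₂ F₃ : J.Fraction x y} (t₁ : FractionMap F₁ F₂)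
    (t₂ : FractionMap F₂ F₃) (L : J.Fraction y z) :
    rightWhisker hff (vcomp hsub hff t₁ t₂) L =
      vcomp hsub hff (rightWhisker hff t₁ L) (rightWhisker hff t₂ L) := by
  obtain ⟨T, e, p₁, p₂, p₃, -, he, h₁, h₂, h₃, -⟩ :=
    exists_lifts (𝟙 x) (𝟙 x) (𝟙 x) (𝟙 x) F₁ F₂ F₃ F₃
  obtain ⟨S, e', s₁, s₂, s₃, -, he', hs₁, hs₂, hs₃, -⟩ :=
    exists_lifts (p₁ ≫ F₁.right) (p₂ ≫ F₂.right) (p₃ ≫ F₃.right) (p₃ ≫ F₃.right) L L L L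
  rw [Category.comp_id] at h₁ h₂ h₃
  rw [← Category.assoc] at hs₁ hs₂ hs₃
  have k₁₂ : (e' ≫ p₁) ≫ F₁.left = (e' ≫ p₂) ≫ F₂.left := by
    rw [Category.assoc, ← h₁, h₂, Category.assoc]
  have k₂₃ : (e' ≫ p₂) ≫ F₂.left = (e' ≫ p₃) ≫ F₃.left := by
    rw [Category.assoc, ← h₂, h₃, Category.assoc]
  -- The values of `t₁` and `t₂` lift separately through the left leg of `L`; then `σ ≫ τ` lifts the
  -- value of the composite.
  obtain ⟨σ, hσ, -⟩ := hff _ L.left_cover s₁ s₂ (t₁.app _ _ k₁₂ hs₁.symm hs₂.symm)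
  obtain ⟨τ, hτ, -⟩ := hff _ L.left_cover s₂ s₃ (t₂.app _ _ k₂₃ hs₂.symm hs₃.symm)
  have l₁ := F₁.pair_left L _ s₁ hs₁
  have l₂ := F₂.pair_left L _ s₂ hs₂
  have l₃ := F₃.pair_left L _ s₃ hs₃
  refine app_injective hsub hff (p := F₁.pair L _ s₁ hs₁) (q := F₃.pair L _ s₃ hs₃) ?_
    (by rw [l₁, l₃, k₁₂, k₂₃]) (F₁.pair_right L _ s₁ hs₁).symm (F₃.pair_right L _ s₃ hs₃).symm ?_
  · rw [l₁, Category.assoc, ← h₁]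
    exact J.comp_cover _ _ he' he
  · rw [rightWhisker_app hff _ L hs₁ hs₃ (k₁₂.trans k₂₃) (σ ≫ τ) (by
        rw [vcomp_app hsub hff _ _ (e' ≫ p₂) _ k₁₂ k₂₃ _ hs₂.symm _, comp_whiskerRight, hσ, hτ]),
      vcomp_app hsub hff _ _ (F₂.pair L _ s₂ hs₂) _ (by rw [l₁, l₂, k₁₂]) (by rw [l₂, l₃, k₂₃]) _
        (F₂.pair_right L _ s₂ hs₂).symm _, rightWhisker_app hff _ L hs₁ hs₂ k₁₂ σ hσ,
      rightWhisker_app hff _ L hs₂ hs₃ k₂₃ τ hτ, comp_whiskerRight]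

/-- The lifts `σ` and `τ` through the left legs of `G₁` and `G₂` lie over one value of `t`, so the
law is naturality of the values of `t'` with respect to them. -/
theorem lwhisker_rightWhisker_exchange {F₁ F₂ : J.Fraction x y} {G₁ G₂ : J.Fraction y z}
    (t : FractionMap F₁ F₂) (t' : FractionMap G₁ G₂) :
    vcomp hsub hff (lwhisker hff hsub F₁ t') (rightWhisker hff t G₂) =
      vcomp hsub hff (rightWhisker hff t G₁) (lwhisker hff hsub F₂ t') := by
  obtain ⟨T, e, p₁, p₂, -, -, he, h₁, h₂, -, -⟩ :=
    exists_lifts (𝟙 x) (𝟙 x) (𝟙 x) (𝟙 x) F₁ F₂ F₁ F₁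
  obtain ⟨S, e', s₁₁, s₁₂, s₂₁, s₂₂, he', h₁₁, h₁₂, h₂₁, h₂₂⟩ :=
    exists_lifts (p₁ ≫ F₁.right) (p₁ ≫ F₁.right) (p₂ ≫ F₂.right) (p₂ ≫ F₂.right) G₁ G₂ G₁ G₂
  rw [Category.comp_id] at h₁ h₂
  rw [← Category.assoc] at h₁₁ h₁₂ h₂₁ h₂₂
  have k : (e' ≫ p₁) ≫ F₁.left = (e' ≫ p₂) ≫ F₂.left := by
    rw [Category.assoc, ← h₁, h₂, Category.assoc]
  obtain ⟨σ, hσ, -⟩ := hff _ G₁.left_cover s₁₁ s₂₁ (t.app _ _ k h₁₁.symm h₂₁.symm)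
  obtain ⟨τ, hτ, -⟩ := hff _ G₂.left_cover s₁₂ s₂₂ (t.app _ _ k h₁₂.symm h₂₂.symm)
  have l₁₁ := F₁.pair_left G₁ _ _ h₁₁
  have l₁₂ := F₁.pair_left G₂ _ _ h₁₂
  have l₂₁ := F₂.pair_left G₁ _ _ h₂₁
  have l₂₂ := F₂.pair_left G₂ _ _ h₂₂
  refine app_injective hsub hff (p := F₁.pair G₁ _ _ h₁₁) (q := F₂.pair G₂ _ _ h₂₂) ?_
    (by rw [l₁₁, l₂₂, k]) (F₁.pair_right G₁ _ _ h₁₁).symm (F₂.pair_right G₂ _ _ h₂₂).symm ?_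
  · rw [l₁₁, Category.assoc, ← h₁]
    exact J.comp_cover _ _ he' he
  · rw [vcomp_app hsub hff _ _ (F₁.pair G₂ _ _ h₁₂) _ (by rw [l₁₁, l₁₂]) (by rw [l₁₂, l₂₂, k]) _
        (F₁.pair_right G₂ _ _ h₁₂).symm _,
      vcomp_app hsub hff _ _ (F₂.pair G₁ _ _ h₂₁) _ (by rw [l₁₁, l₂₁, k]) (by rw [l₂₁, l₂₂]) _
        (F₂.pair_right G₁ _ _ h₂₁).symm _,
      lwhisker_app hff hsub F₁ _ h₁₁ h₁₂ _ _ _ rfl rfl,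
      lwhisker_app hff hsub F₂ _ h₂₁ h₂₂ _ _ _ rfl rfl,
      rightWhisker_app hff _ G₁ h₁₁ h₂₁ k σ hσ, rightWhisker_app hff _ G₂ h₁₂ h₂₂ k τ hτ]
    have := t'.app_naturality hff σ τ (h₁₁.symm.trans h₁₂) (h₂₁.symm.trans h₂₂)
      (by rw [hσ, hτ, recast_app]) rfl rfl rfl rfl
    rwa [recast_rfl, recast_rfl] at this

end Structure


open FractionMap

/-! ### Associativity -/

section Associator

variable {x₁ x₂ x₃ x₄ x₅ : K} (hsub : J.Subcanonical) (hff : J.ContainedInFF)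

theorem assocArrow_fst (F : J.Fraction x₁ x₂) (G : J.Fraction x₂ x₃) (H : J.Fraction x₃ x₄) :
    assocArrow F G H ≫ (J.pb F.right (G.comp H).left (G.comp H).left_cover).fst =
      (J.pb (F.comp G).right H.left H.left_cover).fst ≫ (J.pb F.right G.left G.left_cover).fst :=
  J.lift_fst _ _ _ _ _ _

theorem assocArrow_snd (F : J.Fraction x₁ x₂) (G : J.Fraction x₂ x₃) (H : J.Fraction x₃ x₄) :
    assocArrow F G H ≫ (J.pb F.right (G.comp H).left (G.comp H).left_cover).snd =
      assocArrowSnd F G H :=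
  J.lift_snd _ _ _ _ _ _

/-- The 1-arrow into `(u × v) × w` with components `p`, `s`, `r`. -/
abbrev Fraction.tripleLeft (F : J.Fraction x₁ x₂) (G : J.Fraction x₂ x₃) (H : J.Fraction x₃ x₄)
    {T : K} (p : T ⟶ F.pt) (s : T ⟶ G.pt) (r : T ⟶ H.pt) (hs : p ≫ F.right = s ≫ G.left)
    (hr : s ≫ G.right = r ≫ H.left) : T ⟶ ((F.comp G).comp H).pt :=
  (F.comp G).pair H (F.pair G p s hs) r ((F.pair_right G p s hs).trans hr)

/-- The 1-arrow into `u × (v × w)` with components `p`, `s`, `r`. -/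
abbrev Fraction.tripleRight (F : J.Fraction x₁ x₂) (G : J.Fraction x₂ x₃) (H : J.Fraction x₃ x₄)
    {T : K} (p : T ⟶ F.pt) (s : T ⟶ G.pt) (r : T ⟶ H.pt) (hs : p ≫ F.right = s ≫ G.left)
    (hr : s ≫ G.right = r ≫ H.left) : T ⟶ (F.comp (G.comp H)).pt :=
  F.pair (G.comp H) p (G.pair H s r hr) (hs.trans (G.pair_left H s r hr).symm)

section

variable (F : J.Fraction x₁ x₂) (G : J.Fraction x₂ x₃) (H : J.Fraction x₃ x₄)
    {T : K} (p : T ⟶ F.pt) (s : T ⟶ G.pt) (r : T ⟶ H.pt) (hs : p ≫ F.right = s ≫ G.left)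
    (hr : s ≫ G.right = r ≫ H.left)

theorem Fraction.tripleLeft_left :
    F.tripleLeft G H p s r hs hr ≫ ((F.comp G).comp H).left = p ≫ F.left := by
  rw [Fraction.pair_left, Fraction.pair_left]

theorem Fraction.tripleRight_left :
    F.tripleRight G H p s r hs hr ≫ (F.comp (G.comp H)).left = p ≫ F.left := by
  rw [Fraction.pair_left]

theorem Fraction.tripleLeft_right :
    F.tripleLeft G H p s r hs hr ≫ ((F.comp G).comp H).right = r ≫ H.right := by
  rw [Fraction.pair_right]

theorem Fraction.tripleRight_right :
    F.tripleRight G H p s r hs hr ≫ (F.comp (G.comp H)).right = r ≫ H.right := by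
  rw [Fraction.pair_right, Fraction.pair_right]

/-- The canonical 1-arrow rebrackets triples and leaves the components unchanged; hence the
associator has identity values at such pairs. -/
theorem Fraction.tripleLeft_assocArrow :
    F.tripleLeft G H p s r hs hr ≫ assocArrow F G H = F.tripleRight G H p s r hs hr := by
  refine pb_hom_ext ?_ (pb_hom_ext ?_ ?_)
  · rw [Category.assoc, assocArrow_fst, ← Category.assoc, Fraction.pair_fst, Fraction.pair_fst,
      Fraction.pair_fst]
  · rw [Category.assoc, Category.assoc, ← Category.assoc (assocArrow F G H), assocArrow_snd,
      assocArrowSnd, J.lift_fst, ← Category.assoc, Fraction.pair_fst, Fraction.pair_snd,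
      Fraction.pair_snd, Fraction.pair_fst]
  · rw [Category.assoc, Category.assoc, ← Category.assoc (assocArrow F G H), assocArrow_snd,
      assocArrowSnd, J.lift_snd, Fraction.pair_snd, Fraction.pair_snd, Fraction.pair_snd]

/-- The associator of three composable fractions. -/
abbrev assocMap : FractionMap ((F.comp G).comp H) (F.comp (G.comp H)) :=
  (assocRenaming F G H).toMap hff

theorem assocMap_app (h) {m : T ⟶ x₄} (hm hn) :
    (assocMap hff F G H).app (F.tripleLeft G H p s r hs hr) (F.tripleRight G H p s r hs hr) h
      (m := m) hm hn = 𝟙 m :=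
  (assocRenaming F G H).toMap_app_of_eqToHom hff (assocArrow_right F G H) rfl
    (F.tripleLeft_assocArrow G H p s r hs hr) h hm hn

end

/-- At triples sharing their first two components both sides have value `t.app r r'`. -/
theorem lwhisker_comp_assocMap (F : J.Fraction x₁ x₂) (G : J.Fraction x₂ x₃)
    {H H' : J.Fraction x₃ x₄} (t : FractionMap H H') :
    vcomp hsub hff (lwhisker hff hsub (F.comp G) t) (assocMap hff F G H') =
      vcomp hsub hff (assocMap hff F G H) (lwhisker hff hsub F (lwhisker hff hsub G t)) := by
  obtain ⟨T, p, s, hp, hs⟩ := exists_lift F.right G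
  obtain ⟨S, e, r, r', -, -, he, hr, hr', -, -⟩ :=
    exists_lifts (s ≫ G.right) (s ≫ G.right) (s ≫ G.right) (s ≫ G.right) H H' H H
  replace hs : (e ≫ p) ≫ F.right = (e ≫ s) ≫ G.left := by rw [Category.assoc, hs, Category.assoc]
  rw [← Category.assoc] at hr hr'
  have l := F.tripleLeft_left G H _ _ r hs hr
  have l' := F.tripleLeft_left G H' _ _ r' hs hr'
  have k := F.tripleRight_left G H _ _ r hs hr
  have k' := F.tripleRight_left G H' _ _ r' hs hr'
  refine app_injective hsub hff (p := F.tripleLeft G H _ _ r hs hr)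
    (q := F.tripleRight G H' _ _ r' hs hr') ?_ (l.trans k'.symm)
    (F.tripleLeft_right G H _ _ r hs hr).symm (F.tripleRight_right G H' _ _ r' hs hr').symm ?_
  · rw [l, Category.assoc]
    exact J.comp_cover _ _ he (J.comp_cover _ _ hp F.left_cover)
  · rw [vcomp_app hsub hff _ _ (F.tripleLeft G H' _ _ r' hs hr') _ (l.trans l'.symm)
        (l'.trans k'.symm) _ (F.tripleLeft_right G H' _ _ r' hs hr').symm _,
      vcomp_app hsub hff _ _ (F.tripleRight G H _ _ r hs hr) _ (l.trans k.symm)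
        (k.trans k'.symm) _ (F.tripleRight_right G H _ _ r hs hr).symm _,
      assocMap_app, assocMap_app, lwhisker_app hff hsub _ _ _ _ _ _ _ rfl rfl,
      lwhisker_app hff hsub F _ _ _ _ _ _ (G.pair_right H _ _ hr).symm
        (G.pair_right H' _ _ hr').symm, lwhisker_app hff hsub G _ hr hr' _ _ _ rfl rfl,
      Category.comp_id, Category.id_comp]

/-- One lift `σ` of the value of `t` through the left leg of `H` serves both orders of whiskering.
-/
theorem rightWhisker_lwhisker_assocMap (F : J.Fraction x₁ x₂) {G G' : J.Fraction x₂ x₃}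
    (t : FractionMap G G') (H : J.Fraction x₃ x₄) :
    vcomp hsub hff (rightWhisker hff (lwhisker hff hsub F t) H) (assocMap hff F G' H) =
      vcomp hsub hff (assocMap hff F G H) (lwhisker hff hsub F (rightWhisker hff t H)) := by
  obtain ⟨T, p, s, s', -, -, hp, hs, hs', -, -⟩ :=
    exists_lifts F.right F.right F.right F.right G G' G G
  obtain ⟨S, e, r, r', -, -, he, hr, hr', -, -⟩ :=
    exists_lifts (s ≫ G.right) (s' ≫ G'.right) (s ≫ G.right) (s ≫ G.right) H H H H
  replace hs : (e ≫ p) ≫ F.right = (e ≫ s) ≫ G.left := by rw [Category.assoc, hs, Category.assoc]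
  replace hs' : (e ≫ p) ≫ F.right = (e ≫ s') ≫ G'.left := by
    rw [Category.assoc, hs', Category.assoc]
  rw [← Category.assoc] at hr hr'
  have l := F.tripleLeft_left G H _ _ r hs hr
  have l' := F.tripleLeft_left G' H _ _ r' hs' hr'
  have k := F.tripleRight_left G H _ _ r hs hr
  have k' := F.tripleRight_left G' H _ _ r' hs' hr'
  obtain ⟨σ, hσ, -⟩ := hff _ H.left_cover r r' (t.app _ _ (hs.symm.trans hs') hr.symm hr'.symm)
  refine app_injective hsub hff (p := F.tripleLeft G H _ _ r hs hr)
    (q := F.tripleRight G' H _ _ r' hs' hr') ?_ (l.trans k'.symm)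
    (F.tripleLeft_right G H _ _ r hs hr).symm (F.tripleRight_right G' H _ _ r' hs' hr').symm ?_
  · rw [l, Category.assoc]
    exact J.comp_cover _ _ he (J.comp_cover _ _ hp F.left_cover)
  · rw [vcomp_app hsub hff _ _ (F.tripleLeft G' H _ _ r' hs' hr') _ (l.trans l'.symm)
        (l'.trans k'.symm) _ (F.tripleLeft_right G' H _ _ r' hs' hr').symm _,
      vcomp_app hsub hff _ _ (F.tripleRight G H _ _ r hs hr) _ (l.trans k.symm)
        (k.trans k'.symm) _ (F.tripleRight_right G H _ _ r hs hr).symm _,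
      assocMap_app, assocMap_app, rightWhisker_app hff _ H _ _
        (by rw [F.pair_left, F.pair_left]) σ (by
          rw [hσ, lwhisker_app hff hsub F t hs hs']),
      lwhisker_app hff hsub F _ _ _ _ _ _ (G.pair_right H _ _ hr).symm
        (G'.pair_right H _ _ hr').symm, rightWhisker_app hff t H hr hr' _ σ hσ,
      Category.comp_id, Category.id_comp]

theorem rightWhisker_comp_assocMap {F F' : J.Fraction x₁ x₂} (t : FractionMap F F')
    (G : J.Fraction x₂ x₃) (H : J.Fraction x₃ x₄) :
    vcomp hsub hff (rightWhisker hff (rightWhisker hff t G) H) (assocMap hff F' G H) =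
      vcomp hsub hff (assocMap hff F G H) (rightWhisker hff t (G.comp H)) := by
  obtain ⟨T, d, p, p', -, -, hd, hp, hp', -, -⟩ :=
    exists_lifts (𝟙 x₁) (𝟙 x₁) (𝟙 x₁) (𝟙 x₁) F F' F F
  obtain ⟨S, e, s, s', -, -, he, hs, hs', -, -⟩ :=
    exists_lifts (p ≫ F.right) (p' ≫ F'.right) (p ≫ F.right) (p ≫ F.right) G G G G
  obtain ⟨R, f, r, r', -, -, hf, hr, hr', -, -⟩ :=
    exists_lifts (s ≫ G.right) (s' ≫ G.right) (s ≫ G.right) (s ≫ G.right) H H H H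
  rw [Category.comp_id] at hp hp'
  replace hs : (f ≫ e ≫ p) ≫ F.right = (f ≫ s) ≫ G.left := by simp only [Category.assoc, hs]
  replace hs' : (f ≫ e ≫ p') ≫ F'.right = (f ≫ s') ≫ G.left := by simp only [Category.assoc, hs']
  have h : (f ≫ e ≫ p) ≫ F.left = (f ≫ e ≫ p') ≫ F'.left := by
    simp only [Category.assoc, ← hp, ← hp']
  rw [← Category.assoc] at hr hr'
  have l := F.tripleLeft_left G H _ _ r hs hr
  have l' := F'.tripleLeft_left G H _ _ r' hs' hr'
  have k := F.tripleRight_left G H _ _ r hs hr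
  have k' := F'.tripleRight_left G H _ _ r' hs' hr'
  obtain ⟨σ, hσ, -⟩ := hff _ G.left_cover _ _ (t.app _ _ h hs.symm hs'.symm)
  obtain ⟨τ, hτ, -⟩ := hff _ H.left_cover _ _ (recast (σ ▷ G.right) hr.symm hr'.symm)
  -- Whiskering once by the composite fraction lifts `t` through a composite cover. By faithfulness,
  -- the components of `ρ` are the lifts `σ` and `τ` from the two-step whiskering, so both sides are
  -- `τ ▷ H.right` up to transport.
  obtain ⟨ρ, hρ, -⟩ := hff _ (G.comp H).left_cover _ _ (t.app _ _ h
    (hs.trans (G.pair_left H _ _ hr).symm).symm (hs'.trans (G.pair_left H _ _ hr').symm).symm)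
  have hρ₁ : ρ ▷ (J.pb G.right H.left H.left_cover).fst =
      recast σ (G.pair_fst H _ _ hr) (G.pair_fst H _ _ hr') := by
    apply (hff _ G.left_cover).ext
    rw [whiskerRight_whiskerRight_eq, hρ, recast_whiskerRight, hσ, recast_app, recast_app]
  have hρ₂ : ρ ▷ (J.pb G.right H.left H.left_cover).snd =
      recast τ (G.pair_snd H _ _ hr) (G.pair_snd H _ _ hr') := by
    apply (hff _ H.left_cover).ext
    rw [whiskerRight_whiskerRight_eq, whiskerRight_eq_of_eq (J.condition G.right H.left _).symm,
      whiskerRight_comp_eq, hρ₁, recast_whiskerRight, recast_whiskerRight, hτ]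
    simp only [recast_recast]
  refine app_injective hsub hff (p := F.tripleLeft G H _ _ r hs hr)
    (q := F'.tripleRight G H _ _ r' hs' hr') ?_ (l.trans (h.trans k'.symm))
    (F.tripleLeft_right G H _ _ r hs hr).symm (F'.tripleRight_right G H _ _ r' hs' hr').symm ?_
  · rw [l]
    simp only [Category.assoc, ← hp]
    exact J.comp_cover _ _ hf (J.comp_cover _ _ he hd)
  · rw [vcomp_app hsub hff _ _ (F'.tripleLeft G H _ _ r' hs' hr') _ (l.trans (h.trans l'.symm))
        (l'.trans k'.symm) _ (F'.tripleLeft_right G H _ _ r' hs' hr').symm _,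
      vcomp_app hsub hff _ _ (F.tripleRight G H _ _ r hs hr) _ (l.trans k.symm)
        (k.trans (h.trans k'.symm)) _ (F.tripleRight_right G H _ _ r hs hr).symm _,
      assocMap_app, assocMap_app, Category.comp_id, Category.id_comp,
      rightWhisker_app hff _ H _ _ (by rw [F.pair_left, F'.pair_left, h]) τ (by
        rw [hτ, rightWhisker_app_eq_recast hff t G hs hs' h σ hσ _ _ _ hr.symm hr'.symm]),
      rightWhisker_app_eq_recast hff t (G.comp H) _ _ h ρ hρ _ _ _ (G.pair_right H _ _ hr).symm
        (G.pair_right H _ _ hr').symm, whiskerRight_comp_eq, hρ₂]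
    simp

/-- At the five bracketings of one quadruple (p', s', r', q) every map involved has an identity
value. -/
theorem pentagon_assocMap (F : J.Fraction x₁ x₂) (G : J.Fraction x₂ x₃) (H : J.Fraction x₃ x₄)
    (I : J.Fraction x₄ x₅) :
    vcomp hsub hff (rightWhisker hff (assocMap hff F G H) I)
        (vcomp hsub hff (assocMap hff F (G.comp H) I) (lwhisker hff hsub F (assocMap hff G H I))) =
      vcomp hsub hff (assocMap hff (F.comp G) H I) (assocMap hff F G (H.comp I)) := by
  obtain ⟨T₁, p, s, hp, hs⟩ := exists_lift F.right G
  obtain ⟨T₂, e, r, he, hr⟩ := exists_lift (s ≫ G.right) H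
  obtain ⟨T₃, f, q, hf, hq⟩ := exists_lift (r ≫ H.right) I
  replace hs : (f ≫ e ≫ p) ≫ F.right = (f ≫ e ≫ s) ≫ G.left := by simp only [Category.assoc, hs]
  replace hr : (f ≫ e ≫ s) ≫ G.right = (f ≫ r) ≫ H.left := by simp only [Category.assoc, hr]
  replace hq : (f ≫ r) ≫ H.right = q ≫ I.left := by rw [← hq, Category.assoc]
  set p' := f ≫ e ≫ p
  set s' := f ≫ e ≫ s
  set r' := f ≫ r
  have hrq : r' ≫ H.right = q ≫ I.left := hq
  have hr₁ : s' ≫ G.right = (H.pair I r' q hq) ≫ (H.comp I).left :=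
    hr.trans (H.pair_left I r' q hq).symm
  have hs₁ : p' ≫ F.right = G.pair H s' r' hr ≫ (G.comp H).left :=
    hs.trans (G.pair_left H s' r' hr).symm
  have hq₁ : G.pair H s' r' hr ≫ (G.comp H).right = q ≫ I.left :=
    (G.pair_right H s' r' hr).trans hq
  have hr₂ : F.pair G p' s' hs ≫ (F.comp G).right = r' ≫ H.left :=
    (F.pair_right G p' s' hs).trans hr
  have a₀ := (F.comp G).tripleLeft_left H I _ _ _ hr₂ hq
  have a₁ := F.tripleLeft_left (G.comp H) I _ _ _ hs₁ hq₁
  have a₂ := F.tripleRight_left (G.comp H) I _ _ _ hs₁ hq₁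
  have a₃ := F.tripleRight_left G (H.comp I) _ _ _ hs hr₁
  have b₁ := F.tripleLeft_left G (H.comp I) _ _ _ hs hr₁
  rw [F.pair_left G p' s' hs] at a₀
  refine app_injective hsub hff (p := (F.comp G).tripleLeft H I _ _ _ hr₂ hq)
    (q := F.tripleRight G (H.comp I) _ _ _ hs hr₁) ?_ (a₀.trans a₃.symm)
    ((F.comp G).tripleLeft_right H I _ _ _ hr₂ hq).symm
    ((F.tripleRight_right G (H.comp I) _ _ _ hs hr₁).trans (H.pair_right I r' q hq)).symm ?_
  · rw [a₀]
    simp only [p', Category.assoc]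
    exact J.comp_cover _ _ hf (J.comp_cover _ _ he (J.comp_cover _ _ hp F.left_cover))
  · rw [vcomp_app hsub hff _ _ (F.tripleLeft (G.comp H) I _ _ _ hs₁ hq₁) _ (a₀.trans a₁.symm)
        (a₁.trans a₃.symm) _ (F.tripleLeft_right (G.comp H) I _ _ _ hs₁ hq₁).symm _,
      vcomp_app hsub hff _ _ (F.tripleRight (G.comp H) I _ _ _ hs₁ hq₁) _ (a₁.trans a₂.symm)
        (a₂.trans a₃.symm) _ (F.tripleRight_right (G.comp H) I _ _ _ hs₁ hq₁).symm _,
      vcomp_app hsub hff _ _ (F.tripleLeft G (H.comp I) _ _ _ hs hr₁) _ (a₀.trans b₁.symm)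
        (b₁.trans a₃.symm) _
        ((F.tripleLeft_right G (H.comp I) _ _ _ hs hr₁).trans (H.pair_right I r' q hq)).symm _,
      assocMap_app, assocMap_app, assocMap_app,
      rightWhisker_app hff _ I _ _
        ((F.tripleLeft_left G H _ _ _ hs hr).trans (F.tripleRight_left G H _ _ _ hs hr).symm)
        (𝟙 q) (by rw [assocMap_app, id_whiskerRight]),
      lwhisker_app hff hsub F _ _ _ _ _ _ (G.tripleLeft_right H I _ _ _ hr hq).symm
        (G.tripleRight_right H I _ _ _ hr hq).symm, assocMap_app, id_whiskerRight]
    simp only [Category.comp_id]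

end Associator

/-! ### Unit laws -/

section Unit

variable {x y z : K} (hsub : J.Subcanonical) (hff : J.ContainedInFF)

theorem Fraction.id_comp (F : J.Fraction x y) : (Fraction.id J x).comp F = F := by
  -- The span is generalized to a variable, so that its equality with the trivial pullback can be
  -- substituted in the dependent fields as well.
  have key (P : BareSpan x F.pt) (hP : P = ⟨F.pt, F.left, 𝟙 F.pt⟩) (hc : J.cover (P.fst ≫ 𝟙 x)) :
      (⟨P.pt, P.fst ≫ 𝟙 x, hc, P.snd ≫ F.right⟩ : J.Fraction x y) = F := by
    subst hP
    simp only [Category.id_comp, Category.comp_id]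
  exact key _ (J.pb_along_id F.left F.left_cover) _

theorem Fraction.comp_id (F : J.Fraction x y) : F.comp (Fraction.id J y) = F := by
  have key (P : BareSpan F.pt y) (hP : P = ⟨F.pt, 𝟙 F.pt, F.right⟩)
      (hc : J.cover (P.fst ≫ F.left)) :
      (⟨P.pt, P.fst ≫ F.left, hc, P.snd ≫ 𝟙 y⟩ : J.Fraction x y) = F := by
    subst hP
    simp only [Category.id_comp, Category.comp_id]
  exact key _ (J.pb_of_id F.right) _

/-- The identity map between equal fractions. -/
def FractionMap.ofEq {F G : J.Fraction x y} (e : F = G) : FractionMap F G :=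
  letI := fractionCategory hsub hff x y
  eqToHom e

/-- The two lifts have targets that are only propositionally equal, hence `≍`; after substitution
this is the identity map. -/
theorem FractionMap.ofEq_app {F G : J.Fraction x y} (e : F = G) {T : K} {p : T ⟶ F.pt}
    {q : T ⟶ G.pt} (hpq : p ≍ q) (h) {m : T ⟶ y} (hm hn) :
    (FractionMap.ofEq hsub hff e).app p q h (m := m) hm hn = 𝟙 m := by
  subst e
  obtain rfl := eq_of_heq hpq
  exact idMap_app hff _ _ _ _ _

/-- The second projection of the trivial pullback becomes an identity once its span is substituted,
so composing with it changes nothing. -/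
theorem Fraction.id_pair (F : J.Fraction x y) {T : K} (p : T ⟶ x) (s : T ⟶ F.pt) (h) :
    (Fraction.id J x).pair F p s h ≍ s := by
  have key (P : BareSpan x F.pt) (hP : P = ⟨F.pt, F.left, 𝟙 F.pt⟩) (r : T ⟶ P.pt) :
      r ≍ r ≫ P.snd := by
    subst hP
    exact heq_of_eq (Category.comp_id r).symm
  exact (key _ (J.pb_along_id F.left F.left_cover) _).trans
    (heq_of_eq ((Fraction.id J x).pair_snd F p s h))

theorem Fraction.pair_id (F : J.Fraction x y) {T : K} (p : T ⟶ F.pt) (s : T ⟶ y) (h) :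
    F.pair (Fraction.id J y) p s h ≍ p := by
  have key (P : BareSpan F.pt y) (hP : P = ⟨F.pt, 𝟙 F.pt, F.right⟩) (r : T ⟶ P.pt) :
      r ≍ r ≫ P.fst := by
    subst hP
    exact heq_of_eq (Category.comp_id r).symm
  exact (key _ (J.pb_of_id F.right) _).trans
    (heq_of_eq (F.pair_fst (Fraction.id J y) p s h))

/-- The left unitor. -/
abbrev leftUnitMap (F : J.Fraction x y) : FractionMap ((Fraction.id J x).comp F) F :=
  FractionMap.ofEq hsub hff F.id_comp

/-- The right unitor. -/
abbrev rightUnitMap (F : J.Fraction x y) : FractionMap (F.comp (Fraction.id J y)) F :=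
  FractionMap.ofEq hsub hff F.comp_id

theorem lwhisker_id_leftUnitMap {F G : J.Fraction x y} (t : FractionMap F G) :
    vcomp hsub hff (lwhisker hff hsub (Fraction.id J x) t) (leftUnitMap hsub hff G) =
      vcomp hsub hff (leftUnitMap hsub hff F) t := by
  obtain ⟨T, c, p, q, -, -, he, hp, hq, -, -⟩ := exists_lifts (𝟙 x) (𝟙 x) (𝟙 x) (𝟙 x) F G F G
  have l := (Fraction.id J x).pair_left F c p hp
  have l' := (Fraction.id J x).pair_left G c q hq
  refine app_injective hsub hff (p := (Fraction.id J x).pair F c p hp) (q := q) ?_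
    (l.trans hq) ((Fraction.id J x).pair_right F c p hp).symm rfl ?_
  · rw [l]
    exact J.comp_cover _ _ he (J.id_cover x)
  · rw [vcomp_app hsub hff _ _ (Fraction.pair _ G c q hq) _ (l.trans l'.symm) (l'.trans hq) _
        ((Fraction.id J x).pair_right G c q hq).symm _,
      vcomp_app hsub hff _ _ p _ (l.trans hp) (hp.symm.trans hq) _ rfl _,
      ofEq_app hsub hff _ (Fraction.id_pair _ _ _ _),
      ofEq_app hsub hff _ (Fraction.id_pair _ _ _ _),
      lwhisker_app hff hsub _ _ hp hq _ _ _ rfl rfl, Category.comp_id, Category.id_comp]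

theorem rightWhisker_id_rightUnitMap {F G : J.Fraction x y} (t : FractionMap F G) :
    vcomp hsub hff (rightWhisker hff t (Fraction.id J y)) (rightUnitMap hsub hff G) =
      vcomp hsub hff (rightUnitMap hsub hff F) t := by
  obtain ⟨T, c, p, q, -, -, he, hp, hq, -, -⟩ := exists_lifts (𝟙 x) (𝟙 x) (𝟙 x) (𝟙 x) F G F G
  rw [Category.comp_id] at hp hq
  have hs : p ≫ F.right = (p ≫ F.right) ≫ (Fraction.id J y).left := (Category.comp_id _).symm
  have hs' : q ≫ G.right = (q ≫ G.right) ≫ (Fraction.id J y).left := (Category.comp_id _).symm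
  have l := F.pair_left (Fraction.id J y) p _ hs
  have l' := G.pair_left (Fraction.id J y) q _ hs'
  have h := hp.symm.trans hq
  obtain ⟨σ, hσ, -⟩ := hff _ (Fraction.id J y).left_cover _ _ (t.app p q h hs.symm hs'.symm)
  refine app_injective hsub hff (p := F.pair (Fraction.id J y) p _ hs) (q := q) ?_
    (l.trans h) (F.pair_right _ _ _ hs).symm hs'.symm ?_
  · rw [l, ← hp]
    exact he
  · rw [vcomp_app hsub hff _ _ (G.pair _ _ _ hs') _ (l.trans (h.trans l'.symm)) l' _
        (G.pair_right _ _ _ hs').symm _,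
      vcomp_app hsub hff _ _ p _ l h _ hs.symm _,
      ofEq_app hsub hff _ (Fraction.pair_id _ _ _ _),
      ofEq_app hsub hff _ (Fraction.pair_id _ _ _ _),
      rightWhisker_app hff t _ hs hs' h σ hσ]
    -- Both legs of the identity fraction are the same identity, so `hσ`, about the left leg, also
    -- computes whiskering with the right leg.
    exact (Category.comp_id _).trans (hσ.trans (Category.id_comp _).symm)

theorem triangle_assocMap (F : J.Fraction x y) (G : J.Fraction y z) :
    vcomp hsub hff (assocMap hff F (Fraction.id J y) G)
        (lwhisker hff hsub F (leftUnitMap hsub hff G)) =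
      rightWhisker hff (rightUnitMap hsub hff F) G := by
  obtain ⟨T, p, s, hp, hs⟩ := exists_lift F.right G
  -- The component in the identity fraction is forced to be `p ≫ F.right`.
  have hi : p ≫ F.right = (p ≫ F.right) ≫ (Fraction.id J y).left := (Category.comp_id _).symm
  have hi' : (p ≫ F.right) ≫ (Fraction.id J y).right = s ≫ G.left := (Category.comp_id _).trans hs
  have l := F.tripleLeft_left (Fraction.id J y) G p _ s hi hi'
  have l' := F.tripleRight_left (Fraction.id J y) G p _ s hi hi'
  have l'' := F.pair_left G p s hs
  refine app_injective hsub hff (p := F.tripleLeft (Fraction.id J y) G p _ s hi hi')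
    (q := F.pair G p s hs) ?_ (l.trans l''.symm) (F.tripleLeft_right _ G p _ s hi hi').symm
    (F.pair_right G p s hs).symm ?_
  · rw [l]
    exact J.comp_cover _ _ hp F.left_cover
  · rw [vcomp_app hsub hff _ _ (F.tripleRight (Fraction.id J y) G p _ s hi hi') _
        (l.trans l'.symm) (l'.trans l''.symm) _ (F.tripleRight_right _ G p _ s hi hi').symm _,
      assocMap_app, lwhisker_app hff hsub F _ _ hs _ _ _
        ((Fraction.id J y).pair_right G _ s hi').symm rfl,
      ofEq_app hsub hff _ (Fraction.id_pair _ _ _ _),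
      rightWhisker_app hff _ G _ hs (F.pair_left _ _ _ hi) (𝟙 s) (by
        rw [ofEq_app hsub hff _ (Fraction.pair_id _ _ _ _), id_whiskerRight]), id_whiskerRight,
      Category.comp_id]

end Unit


open FractionMap

/-! ### The bicategory of fractions -/

section Bicategory

variable (hsub : J.Subcanonical) (hff : J.ContainedInFF)

/-- Converts the naturality squares proved above into the conjugated form of the bicategory axioms.
-/
theorem eq_hom_comp_comp_inv {C : Type*} [Category C] {X Y X' Y' : C} (α : X ≅ Y) (β : X' ≅ Y')
    {g : X ⟶ X'} {f : Y ⟶ Y'} (h : g ≫ β.hom = α.hom ≫ f) : g = α.hom ≫ f ≫ β.inv := by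
  rw [← Category.assoc, Iso.eq_comp_inv, h]

theorem eq_inv_comp_comp_hom {C : Type*} [Category C] {X Y X' Y' : C} (α : X ≅ Y) (β : X' ≅ Y')
    {g : X ⟶ X'} {f : Y ⟶ Y'} (h : g ≫ β.hom = α.hom ≫ f) : f = α.inv ≫ g ≫ β.hom := by
  rw [Iso.eq_inv_comp, h]

/-- The associator as an isomorphism. -/
def assocIso {x₁ x₂ x₃ x₄ : K} (F : J.Fraction x₁ x₂) (G : J.Fraction x₂ x₃)
    (H : J.Fraction x₃ x₄) :
    letI := fractionCategory hsub hff x₁ x₄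
    (F.comp G).comp H ≅ F.comp (G.comp H) :=
  letI := fractionCategory hsub hff x₁ x₄
  have h := (assocRenaming F G H).exists_inverse hsub hff (assocArrow_right F G H) rfl
  { hom := assocMap hff F G H
    inv := h.choose
    hom_inv_id := h.choose_spec.1
    inv_hom_id := h.choose_spec.2 }

/-- The bicategory of fractions. -/
abbrev fractionBicategory : Bicategory.{w, max u v} J.FractionBicat where
  Hom x y := J.Fraction (x : K) y
  id x := Fraction.id J x
  comp F G := Fraction.comp F G
  homCategory x y := fractionCategory hsub hff (x : K) y
  whiskerLeft F _ _ t := lwhisker hff hsub F t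
  whiskerRight t L := rightWhisker hff t L
  associator F G H := assocIso hsub hff F G H
  leftUnitor {x y} F :=
    letI := fractionCategory hsub hff (x : K) y
    eqToIso (Fraction.id_comp F)
  rightUnitor {x y} F :=
    letI := fractionCategory hsub hff (x : K) y
    eqToIso (Fraction.comp_id F)
  whiskerLeft_id := lwhisker_id hsub hff
  whiskerLeft_comp F _ _ _ t₁ t₂ := lwhisker_vcomp hsub hff F t₁ t₂
  id_whiskerLeft {x y _ _} t :=
    letI := fractionCategory hsub hff (x : K) y
    eq_hom_comp_comp_inv (C := J.Fraction (x : K) y) (eqToIso (Fraction.id_comp _))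
      (eqToIso (Fraction.id_comp _))
      (lwhisker_id_leftUnitMap hsub hff t)
  comp_whiskerLeft {x₁ _ _ x₄} F G _ _ t :=
    letI := fractionCategory hsub hff (x₁ : K) x₄
    eq_hom_comp_comp_inv (assocIso hsub hff F G _) (assocIso hsub hff F G _)
      (lwhisker_comp_assocMap hsub hff F G t)
  id_whiskerRight F L := rightWhisker_id hff hsub F L
  comp_whiskerRight t₁ t₂ L := rightWhisker_vcomp hsub hff t₁ t₂ L
  whiskerRight_id {x y _ _} t :=
    letI := fractionCategory hsub hff (x : K) y
    eq_hom_comp_comp_inv (C := J.Fraction (x : K) y) (eqToIso (Fraction.comp_id _))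
      (eqToIso (Fraction.comp_id _))
      (rightWhisker_id_rightUnitMap hsub hff t)
  whiskerRight_comp {x₁ _ _ x₄ _ _} t G H :=
    letI := fractionCategory hsub hff (x₁ : K) x₄
    eq_inv_comp_comp_hom (assocIso hsub hff _ G H) (assocIso hsub hff _ G H)
      (rightWhisker_comp_assocMap hsub hff t G H)
  whisker_assoc {x₁ _ _ x₄} F _ _ t H :=
    letI := fractionCategory hsub hff (x₁ : K) x₄
    eq_hom_comp_comp_inv (assocIso hsub hff F _ H) (assocIso hsub hff F _ H)
      (rightWhisker_lwhisker_assocMap hsub hff F t H)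
  whisker_exchange t t' := lwhisker_rightWhisker_exchange hsub hff t t'
  pentagon F G H I := pentagon_assocMap hsub hff F G H I
  triangle F G := triangle_assocMap hsub hff F G

end Bicategory

end StrictPretopology

end

theorem mainTheorem1 {K : Type u} [Bicategory.{w, v} K] [Bicategory.Strict K]
    (J : StrictPretopology K) (hsub : J.Subcanonical) (hff : J.ContainedInFF) :
    ∃ (vcomp : J.VComp) (lwhisker : J.LWhisker)
      (B : Bicategory.{w, max u v} J.FractionBicat),
      (∀ {x y : K} {F G H : J.Fraction x y} (t₁ : StrictPretopology.FractionMap F G)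
        (t₂ : StrictPretopology.FractionMap G H) (s : StrictPretopology.FractionMap F H),
        StrictPretopology.IsVerticalComp t₁ t₂ s ↔ s = vcomp t₁ t₂) ∧
      (∀ {x y z : K} (F : J.Fraction x y) {G H : J.Fraction y z}
        (t : StrictPretopology.FractionMap G H)
        (s : StrictPretopology.FractionMap (F.comp G) (F.comp H)),
        StrictPretopology.IsLeftWhisker hff F t s ↔ s = lwhisker F t) ∧
      B.operations = J.operations hff vcomp lwhisker ∧
      B.StrictlyUnital := by
  -- The operations and the unitors agree by `rfl`, since the bicategory was built from exactly
  -- these data.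
  refine ⟨StrictPretopology.FractionMap.vcomp hsub hff, StrictPretopology.lwhisker hff hsub,
    StrictPretopology.fractionBicategory hsub hff,
    StrictPretopology.FractionMap.isVerticalComp_iff_eq_vcomp hsub hff,
    StrictPretopology.isLeftWhisker_iff_eq_lwhisker hff hsub, rfl, fun F =>
      ⟨⟨F.id_comp, rfl⟩, ⟨F.comp_id, rfl⟩⟩⟩
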